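/- Let $n\ge 0$ be an integer, let $\mathbb T^{2n}=\mathbb R^{2n}/\mathbb Z^{2n}$ with Lebesgue measure of total mass $1$, and let $f\in C^\infty(\mathbb T^{2n};\mathbb C)$, regarded as a $\mathbb Z^{2n}$-periodic function of $(x,\xi)\in\mathbb R^n\times\mathbb R^n$. For an integer $N\ge 1$ put $h=1/(2\pi N)$ and $$Q_j=N^{-n/2}\sum_{\ell\in\mathbb Z^n}\delta(x-\ell-j/N)\in\mathcal S'(\mathbb R^n),\qquad j\in(\mathbb Z/N\mathbb Z)^n,$$ and let $f_N\in M_{N^n}(\mathbb C)$ be the matrix, in the (linearly independent, declared orthonormal) system $(Q_j)$, of the Weyl quantization $$[f^w(x,hD)u](x)=\frac1{(2\pi h)^n}\iint f\Big(\frac{x+y}2,\xi\Big)e^{\frac ih\langle x-y,\xi\rangle}u(y)\,dy\,d\xi$$ extended to $\mathcal S'(\mathbb R^n)$ by duality, that is $f^w(x,hD)Q_j=\sum_m (f_N)_{mj}Q_m$; this matrix exists and is unique. Let $f_N^*$ be its conjugate transpose, and define $\psi(A)$ for a self-adjoint matrix $A$ by the functional calculus. Suppose that for some $\kappa>0$ $$\mathrm{vol}_{\mathbb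 T^{2n}}\big(\{w:|f(w)|\le t\}\big)=\mathcal O(t^\kappa),\qquad 0\le t\ll1 .$$ Let $\rho<1/2$ and let $K\subset\mathbb R$ be compact. Then there are constants $C>0$ and $\alpha_0>0$ (depending only on $n,f,\kappa,\rho,K$) such that for every $\psi\in C_c^\infty(\mathbb R;\mathbb C)$ with $\operatorname{supp}\psi\subset K$, every $N\ge1$ and every $\alpha$ with $N^{-\rho}\le\alpha\le\alpha_0$, $$\operatorname{rank}\,\psi\!\left(\frac{f_Nf_N^*}{\alpha^2}\right)\le C\,N^n\,\alpha^\kappa .$$ -/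

import Mathlib

open scoped ContDiff SchwartzMap

noncomputable section

namespace TorusQuantization

/-- Smooth complex-valued functions on `𝕋²ⁿ = ℝ²ⁿ / ℤ²ⁿ`, identified with smooth
`ℤ²ⁿ`-periodic functions of `(x, ξ) ∈ ℝⁿ × ℝⁿ`. -/
structure IsSmoothOnTorus {n : ℕ}
    (f : EuclideanSpace ℝ (Fin n) × EuclideanSpace ℝ (Fin n) → ℂ) : Prop where
  contDiff : ContDiff ℝ ∞ f
  periodic : ∀ (k l : Fin n → ℤ) (x ξ : EuclideanSpace ℝ (Fin n)),
    f (x + WithLp.toLp 2 (fun i => (k i : ℝ)), ξ + WithLp.toLp 2 (fun i => (l i : ℝ))) = f (x, ξ)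

/-- The fundamental domain `[0,1)²ⁿ` of the torus; it has Lebesgue measure one. -/
def fundamentalCube (n : ℕ) : Set (EuclideanSpace ℝ (Fin n) × EuclideanSpace ℝ (Fin n)) :=
  {w | ∀ i, w.1 i ∈ Set.Ico (0 : ℝ) 1 ∧ w.2 i ∈ Set.Ico (0 : ℝ) 1}

/-- `vol_{𝕋²ⁿ} {w : |f(w) - z| ≤ t} = O(t^κ)` for `0 ≤ t ≪ 1`. -/
def SublevelVolumeBound {n : ℕ}
    (f : EuclideanSpace ℝ (Fin n) × EuclideanSpace ℝ (Fin n) → ℂ) (z : ℂ) (κ : ℝ) : Prop :=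
  ∃ C t₀ : ℝ, 0 < t₀ ∧ ∀ t : ℝ, 0 ≤ t → t ≤ t₀ →
    MeasureTheory.volume {w | w ∈ fundamentalCube n ∧ ‖f w - z‖ ≤ t} ≤ ENNReal.ofReal (C * t ^ κ)

/-- The `h`-Weyl quantization `aʷ(x, hD)` acting on a function `u`:
`(2πh)⁻ⁿ ∫ (∫ a((x+y)/2, ξ) exp((i/h)⟨x-y, ξ⟩) u(y) dy) dξ`.
The integral is iterated (first in `y`): for a bounded smooth symbol with bounded derivatives
and a Schwartz function `u`, the inner integral is rapidly decreasing in `ξ`. -/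
def weylOp {n : ℕ} (h : ℝ) (a : EuclideanSpace ℝ (Fin n) × EuclideanSpace ℝ (Fin n) → ℂ)
    (u : EuclideanSpace ℝ (Fin n) → ℂ) (x : EuclideanSpace ℝ (Fin n)) : ℂ :=
  (((2 * Real.pi * h) ^ n)⁻¹ : ℝ) *
    ∫ ξ : EuclideanSpace ℝ (Fin n), ∫ y : EuclideanSpace ℝ (Fin n),
      a ((1 / 2 : ℝ) • (x + y), ξ) *
        Complex.exp (Complex.I * ((inner ℝ (x - y) ξ / h : ℝ) : ℂ)) * u y

/-- The formal transpose of `aʷ(x, hD)`, which is the Weyl quantization of `a(x, -ξ)`. -/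
def weylTranspose {n : ℕ} (h : ℝ) (a : EuclideanSpace ℝ (Fin n) × EuclideanSpace ℝ (Fin n) → ℂ)
    (u : EuclideanSpace ℝ (Fin n) → ℂ) : EuclideanSpace ℝ (Fin n) → ℂ :=
  weylOp h (fun w => a (w.1, -w.2)) u

/-- The distribution `Q_j = N^{-n/2} ∑_{ℓ ∈ ℤⁿ} δ(x - ℓ - j/N)`, `j ∈ (ℤ/Nℤ)ⁿ`, evaluated on a
function `φ`. The points `ℓ + j/N`, `ℓ ∈ ℤⁿ`, are the points `k/N` with `k ∈ ℤⁿ`, `k ≡ j mod N`. -/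
def comb {n : ℕ} (N : ℕ) (j : Fin n → ZMod N) (φ : EuclideanSpace ℝ (Fin n) → ℂ) : ℂ :=
  ((Real.sqrt ((N : ℝ) ^ n))⁻¹ : ℝ) *
    ∑' k : {k : Fin n → ℤ // ∀ i, (k i : ZMod N) = j i},
      φ (WithLp.toLp 2 (fun i => (k.1 i : ℝ) / N))

/-- `F` is the matrix of `fʷ(x, hD)`, `h = 1/(2πN)`, in the basis `Q_j`, `j ∈ (ℤ/Nℤ)ⁿ`:
`fʷ(x, hD) Q_j = ∑_m F_{mj} Q_m` as tempered distributions. The operator acts on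
distributions by duality, `⟨fʷ Q_j, φ⟩ = ⟨Q_j, (fʷ)ᵗ φ⟩` for all Schwartz functions `φ`. -/
def IsQuantizationMatrix {n : ℕ}
    (f : EuclideanSpace ℝ (Fin n) × EuclideanSpace ℝ (Fin n) → ℂ) (N : ℕ) [NeZero N]
    (F : Matrix (Fin n → ZMod N) (Fin n → ZMod N) ℂ) : Prop :=
  ∀ (j : Fin n → ZMod N) (φ : 𝓢(EuclideanSpace ℝ (Fin n), ℂ)),
    comb N j (weylTranspose (1 / (2 * Real.pi * N)) f φ) = ∑ m, F m j * comb N m φ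

open Classical in
/-- The quantization `f ↦ f_N` of the torus: the matrix of `fʷ(x, hD)`, `h = 1/(2πN)`, restricted
to the span of the `Q_j`, in the basis `(Q_j)`, which is taken to be orthonormal. For `f` smooth on
the torus this matrix exists and is unique. -/
def quantize {n : ℕ} (f : EuclideanSpace ℝ (Fin n) × EuclideanSpace ℝ (Fin n) → ℂ)
    (N : ℕ) [NeZero N] : Matrix (Fin n → ZMod N) (Fin n → ZMod N) ℂ :=
  if h : ∃ F, IsQuantizationMatrix f N F then h.choose else 0

/-- `ψ(A)` for a self-adjoint matrix `A` and a complex-valued function `ψ` on the line, by the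
functional calculus of self-adjoint matrices applied to the real and imaginary parts of `ψ`. -/
def matrixFun {ι : Type*} [Fintype ι] [DecidableEq ι] (ψ : ℝ → ℂ) (A : Matrix ι ι ℂ) :
    Matrix ι ι ℂ :=
  cfc (fun t => (ψ t).re) A + Complex.I • cfc (fun t => (ψ t).im) A

/-! The rest of the file shows that the matrix which defines `quantize` exists and is unique. -/

section WellDefined

open MeasureTheory
open scoped FourierTransform RealInnerProductSpace

variable {n : ℕ}

/-- `exp(2πit)`. -/
def exp2pi (t : ℝ) : ℂ := Complex.exp (((2 * Real.pi * t : ℝ) : ℂ) * Complex.I)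
lemma exp2pi_add (s t : ℝ) : exp2pi (s + t) = exp2pi s * exp2pi t := by
  rw [exp2pi, exp2pi, exp2pi, ← Complex.exp_add]; congr 1; push_cast; ring
lemma norm_exp2pi (t : ℝ) : ‖exp2pi t‖ = 1 := Complex.norm_exp_ofReal_mul_I _
lemma continuous_exp2pi : Continuous exp2pi := by unfold exp2pi; fun_prop
lemma exp2pi_int (m : ℤ) : exp2pi m = 1 := by
  rw [exp2pi, Complex.exp_eq_one_iff]; exact ⟨m, by push_cast; ring⟩

lemma fourier_exp2pi (φ : 𝓢(EuclideanSpace ℝ (Fin n), ℂ)) (w : EuclideanSpace ℝ (Fin n)) : (𝓕 φ : 𝓢(EuclideanSpace ℝ (Fin n), ℂ)) w = ∫ v, exp2pi (-⟪v, w⟫) * φ v := by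
  rw [SchwartzMap.fourier_coe, Real.fourier_eq']
  simp [exp2pi]
lemma fourierInv_exp2pi (φ : 𝓢(EuclideanSpace ℝ (Fin n), ℂ)) (w : EuclideanSpace ℝ (Fin n)) : φ w = ∫ v, exp2pi ⟪v, w⟫ * (𝓕 φ : 𝓢(EuclideanSpace ℝ (Fin n), ℂ)) v := by
  conv_lhs => rw [← FourierTransform.fourierInv_fourier_eq (F := 𝓢(EuclideanSpace ℝ (Fin n), ℂ)) φ]
  rw [SchwartzMap.fourierInv_coe, Real.fourierInv_eq']
  simp [exp2pi]

def intVec (k : Fin n → ℤ) : EuclideanSpace ℝ (Fin n) := WithLp.toLp 2 (fun i => (k i : ℝ))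

def weylTerm (N : ℕ) (x : EuclideanSpace ℝ (Fin n)) (φ : 𝓢(EuclideanSpace ℝ (Fin n), ℂ)) (l m ξ y : EuclideanSpace ℝ (Fin n)) : ℂ :=
  exp2pi (⟪l, (1 / 2 : ℝ) • (x + y)⟫ - ⟪m, ξ⟫) * exp2pi (N * ⟪x - y, ξ⟫) * φ y

lemma norm_weylTerm (N : ℕ) (x : EuclideanSpace ℝ (Fin n)) (φ : 𝓢(EuclideanSpace ℝ (Fin n), ℂ)) (l m ξ y : EuclideanSpace ℝ (Fin n)) :
    ‖weylTerm N x φ l m ξ y‖ = ‖φ y‖ := by simp [weylTerm, norm_exp2pi]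

lemma integrable_weylTerm (N : ℕ) (x : EuclideanSpace ℝ (Fin n)) (φ : 𝓢(EuclideanSpace ℝ (Fin n), ℂ)) (l m ξ : EuclideanSpace ℝ (Fin n)) :
    Integrable (fun y => weylTerm N x φ l m ξ y) := by
  refine (φ.integrable (μ := volume)).mono ?_ (Filter.Eventually.of_forall fun y => (norm_weylTerm _ _ _ _ _ _ _).le)
  apply Continuous.aestronglyMeasurable
  have := continuous_exp2pi
  have := φ.continuous
  unfold weylTerm
  fun_prop

def innerIntegral (N : ℕ) (x : EuclideanSpace ℝ (Fin n)) (φ : 𝓢(EuclideanSpace ℝ (Fin n), ℂ)) (l m η : EuclideanSpace ℝ (Fin n)) : ℂ :=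
  exp2pi (⟪l, x⟫ / 2) * (exp2pi (⟪η + (1 / 2 : ℝ) • l, x - (N : ℝ)⁻¹ • m⟫) * (𝓕 φ : 𝓢(EuclideanSpace ℝ (Fin n), ℂ)) η)

lemma norm_innerIntegral (N : ℕ) (x : EuclideanSpace ℝ (Fin n)) (φ : 𝓢(EuclideanSpace ℝ (Fin n), ℂ)) (l m η : EuclideanSpace ℝ (Fin n)) :
    ‖innerIntegral N x φ l m η‖ = ‖(𝓕 φ : 𝓢(EuclideanSpace ℝ (Fin n), ℂ)) η‖ := by simp [innerIntegral, norm_exp2pi]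

lemma integral_weylTerm (N : ℕ) [NeZero N] (x : EuclideanSpace ℝ (Fin n)) (φ : 𝓢(EuclideanSpace ℝ (Fin n), ℂ)) (l m ξ : EuclideanSpace ℝ (Fin n)) :
    ∫ y, weylTerm N x φ l m ξ y =
      innerIntegral N x φ l m ((N : ℝ) • ξ - (1 / 2 : ℝ) • l) := by
  have hN : (N : ℝ) ≠ 0 := by exact_mod_cast NeZero.ne N
  simp only [innerIntegral, sub_add_cancel]
  rw [fourier_exp2pi, ← mul_assoc, ← integral_const_mul]
  congr 1; funext y
  rw [weylTerm, ← mul_assoc, ← exp2pi_add, ← exp2pi_add, ← exp2pi_add]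
  congr 2
  simp only [inner_sub_left, inner_sub_right, inner_add_right, real_inner_smul_left,
    real_inner_smul_right]
  rw [real_inner_comm ξ x, real_inner_comm m ξ, real_inner_comm l y]
  field_simp
  ring

lemma integrable_innerIntegral (N : ℕ) [NeZero N] (x : EuclideanSpace ℝ (Fin n)) (φ : 𝓢(EuclideanSpace ℝ (Fin n), ℂ)) (l m : EuclideanSpace ℝ (Fin n)) :
    Integrable (innerIntegral N x φ l m) := by
  refine ((𝓕 φ : 𝓢(EuclideanSpace ℝ (Fin n), ℂ)).integrable (μ := volume)).mono ?_ (Filter.Eventually.of_forall fun y => (norm_innerIntegral _ _ _ _ _ _).le)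
  apply Continuous.aestronglyMeasurable
  have := continuous_exp2pi
  have := (𝓕 φ : 𝓢(EuclideanSpace ℝ (Fin n), ℂ)).continuous
  unfold innerIntegral
  fun_prop

lemma integral_affine (N : ℕ) {F : Type*} [NormedAddCommGroup F] [NormedSpace ℝ F] (H : EuclideanSpace ℝ (Fin n) → F) (v : EuclideanSpace ℝ (Fin n)) :
    ∫ ξ, H ((N : ℝ) • ξ - v) = ((N : ℝ) ^ n)⁻¹ • ∫ η, H η := by
  rw [Measure.integral_comp_smul volume (fun η => H (η - v)) (N : ℝ), integral_sub_right_eq_self,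
    abs_of_nonneg (by positivity)]
  simp

lemma weylTranspose_hasSum {ι : Type*} [Countable ι] (N : ℕ) [NeZero N] (f : EuclideanSpace ℝ (Fin n) × EuclideanSpace ℝ (Fin n) → ℂ)
    (c : ι → ℂ) (l m : ι → EuclideanSpace ℝ (Fin n)) (hc : Summable fun q => ‖c q‖)
    (hf : ∀ x ξ, HasSum (fun q => c q * exp2pi (⟪l q, x⟫ + ⟪m q, ξ⟫)) (f (x, ξ)))
    (φ : 𝓢(EuclideanSpace ℝ (Fin n), ℂ)) (x : EuclideanSpace ℝ (Fin n)) :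
    weylTranspose (1 / (2 * Real.pi * N)) f φ x =
      ∑' q, c q * (exp2pi (⟪l q, x⟫ - ⟪l q, (N : ℝ)⁻¹ • m q⟫ / 2) * φ (x - (N : ℝ)⁻¹ • m q)) := by
  have hN : (N : ℝ) ≠ 0 := by exact_mod_cast NeZero.ne N
  have hpi := Real.pi_pos.ne'
  have h1 : ∀ ξ y, f ((1 / 2 : ℝ) • (x + y), -ξ) *
        Complex.exp (Complex.I * ((⟪x - y, ξ⟫ / (1 / (2 * Real.pi * N)) : ℝ) : ℂ)) * φ y
      = ∑' q, c q * weylTerm N x φ (l q) (m q) ξ y := by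
    intro ξ y
    have e : Complex.exp (Complex.I * ((⟪x - y, ξ⟫ / (1 / (2 * Real.pi * N)) : ℝ) : ℂ)) = exp2pi (N * ⟪x - y, ξ⟫) := by
      rw [exp2pi, mul_comm]; congr 3; field_simp
    rw [e]
    have := ((hf ((1 / 2 : ℝ) • (x + y)) (-ξ)).mul_right (exp2pi (N * ⟪x - y, ξ⟫))).mul_right (φ y)
    rw [← this.tsum_eq]
    congr 1; funext q
    rw [weylTerm, inner_neg_right, ← sub_eq_add_neg]; ring
  have h2 : ∀ ξ, ∫ y, f ((1 / 2 : ℝ) • (x + y), -ξ) *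
        Complex.exp (Complex.I * ((⟪x - y, ξ⟫ / (1 / (2 * Real.pi * N)) : ℝ) : ℂ)) * φ y
      = ∑' q, c q * ∫ y, weylTerm N x φ (l q) (m q) ξ y := by
    intro ξ
    simp_rw [h1]
    rw [← integral_tsum_of_summable_integral_norm (fun q => (integrable_weylTerm N x φ (l q) (m q) ξ).const_mul (c q))]
    · simp_rw [integral_const_mul]
    · simp_rw [norm_mul, norm_weylTerm, integral_const_mul]
      exact hc.mul_right _
  unfold weylTranspose weylOp
  simp_rw [h2, integral_weylTerm]
  rw [← integral_tsum_of_summable_integral_norm]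
  · simp_rw [integral_const_mul]
    rw [← tsum_mul_left]
    congr 1; funext q
    rw [integral_affine N (innerIntegral N x φ (l q) (m q)) ((1 / 2 : ℝ) • l q)]
    have h3 : ∫ η : EuclideanSpace ℝ (Fin n), innerIntegral N x φ (l q) (m q) η
        = exp2pi (⟪l q, x⟫ - ⟪l q, (N : ℝ)⁻¹ • m q⟫ / 2) * φ (x - (N : ℝ)⁻¹ • m q) := by
      rw [fourierInv_exp2pi φ, ← integral_const_mul]
      congr 1; funext η
      rw [innerIntegral, ← mul_assoc, ← mul_assoc, ← exp2pi_add, ← exp2pi_add]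
      congr 2
      rw [inner_add_left, real_inner_smul_left, inner_sub_right (l q)]
      ring
    rw [h3]
    have h4 : ((2 * Real.pi * (1 / (2 * Real.pi * N))) ^ n)⁻¹ = (N : ℝ) ^ n := by
      have : 2 * Real.pi * (1 / (2 * Real.pi * N)) = (N : ℝ)⁻¹ := by field_simp
      rw [this, inv_pow, inv_inv]
    rw [h4, Complex.real_smul]
    have h5 : (((N : ℝ) ^ n : ℝ) : ℂ) ≠ 0 := by exact_mod_cast pow_ne_zero n hN
    rw [Complex.ofReal_inv]
    field_simp
  · intro q
    refine Integrable.const_mul ?_ _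
    exact ((integrable_innerIntegral N x φ (l q) (m q)).comp_sub_right ((1 / 2 : ℝ) • l q)).comp_smul hN
  · have h6 : ∀ q, ∫ ξ : EuclideanSpace ℝ (Fin n), ‖c q * innerIntegral N x φ (l q) (m q) ((N : ℝ) • ξ - (1 / 2 : ℝ) • l q)‖
        = ‖c q‖ * (((N : ℝ) ^ n)⁻¹ * ∫ η : EuclideanSpace ℝ (Fin n), ‖(𝓕 φ : 𝓢(EuclideanSpace ℝ (Fin n), ℂ)) η‖) := by
      intro q
      simp only [norm_mul, norm_innerIntegral]
      rw [integral_const_mul, integral_affine N (fun η : EuclideanSpace ℝ (Fin n) => ‖(𝓕 φ : 𝓢(EuclideanSpace ℝ (Fin n), ℂ)) η‖), smul_eq_mul]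
    simp_rw [h6]
    exact hc.mul_right _
variable {d : Type*} [Fintype d]
def torusPt {d : Type*} (w : d → ℝ) : UnitAddTorus d := fun i => (w i : UnitAddCircle)

lemma isOpenQuotientMap_torusPt (d : Type*) [Fintype d] :
    IsOpenQuotientMap (torusPt : (d → ℝ) → UnitAddTorus d) :=
  IsOpenQuotientMap.piMap (fun _ => QuotientAddGroup.isOpenQuotientMap_mk)

lemma mFourier_torusPt (k : d → ℤ) (w : d → ℝ) : UnitAddTorus.mFourier k (torusPt w) =
    Complex.exp (2 * Real.pi * Complex.I * ∑ i, (k i : ℂ) * (w i : ℂ)) := by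
  have : UnitAddTorus.mFourier k (torusPt w) = ∏ i, fourier (k i) ((w i : ℝ) : UnitAddCircle) := rfl
  rw [this, Finset.mul_sum, Complex.exp_sum]
  refine Finset.prod_congr rfl fun i _ => ?_
  rw [fourier_coe_apply]; congr 1; simp; ring

structure PeriodicSmooth (G : (d → ℝ) → ℂ) : Prop where
  contDiff : ContDiff ℝ ∞ G
  periodic : ∀ (k : d → ℤ) (w : d → ℝ), G (w + fun i => (k i : ℝ)) = G w

lemma PeriodicSmooth.desc {G : (d → ℝ) → ℂ} (h : PeriodicSmooth G) :
    ∃ g : C(UnitAddTorus d, ℂ), ∀ w, g (torusPt w) = G w := by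
  have hq := isOpenQuotientMap_torusPt d
  have key : ∀ v w, torusPt v = torusPt w → G v = G w := by
    intro v w hvw
    have : ∀ i, ∃ m : ℤ, v i = w i + m := by
      intro i
      have h1 := congrFun hvw i
      obtain ⟨m, hm⟩ := QuotientAddGroup.eq_iff_sub_mem.1 h1
      exact ⟨m, by simp at hm; linarith⟩
    choose m hm using this
    rw [← h.periodic m w]
    congr 1
    funext i; exact hm i
  let s := Function.surjInv hq.surjective
  have hs : ∀ w, G (s (torusPt w)) = G w := fun w => key _ _ (Function.surjInv_eq hq.surjective _)
  refine ⟨⟨fun t => G (s t), ?_⟩, hs⟩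
  rw [hq.isQuotientMap.continuous_iff]
  exact h.contDiff.continuous.congr (fun w => (hs w).symm)

def partialDeriv [DecidableEq d] (i : d) (G : (d → ℝ) → ℂ) (w : d → ℝ) : ℂ := fderiv ℝ G w (Pi.single i 1)

lemma PeriodicSmooth.pderiv [DecidableEq d] {G : (d → ℝ) → ℂ} (h : PeriodicSmooth G) (i : d) : PeriodicSmooth (partialDeriv i G) where
  contDiff := (h.contDiff.fderiv_right (m := ∞) (by simp)).clm_apply contDiff_const
  periodic k w := by
    unfold partialDeriv
    have : G = fun w => G (w + fun i => (k i : ℝ)) := funext fun w => (h.periodic k w).symm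
    conv_rhs => rw [this]
    rw [fderiv_comp_add_right]

lemma coeff_def (g : UnitAddTorus d → ℂ) (k : d → ℤ) : UnitAddTorus.mFourierCoeff g k =
   ∫ t, UnitAddTorus.mFourier (-k) t • g t ∂(Measure.pi fun _ : d => AddCircle.haarAddCircle) := rfl

lemma coeff_partialDeriv [DecidableEq d] {G : (d → ℝ) → ℂ} (h : PeriodicSmooth G) (i : d) (g g' : C(UnitAddTorus d, ℂ))
    (hg : ∀ w, g (torusPt w) = G w) (hg' : ∀ w, g' (torusPt w) = partialDeriv i G w) (k : d → ℤ) :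
    UnitAddTorus.mFourierCoeff g' k = 2 * Real.pi * Complex.I * k i * UnitAddTorus.mFourierCoeff g k := by
  set μ : Measure (UnitAddTorus d) := (Measure.pi fun _ : d => AddCircle.haarAddCircle) with hμ
  have hpt : ∀ (w : d → ℝ) (s : ℝ), torusPt w + torusPt (Pi.single i s) = torusPt (w + s • Pi.single i 1) := by
    intro w s; funext j
    by_cases hj : j = i
    · subst hj; simp [torusPt]
    · simp [torusPt, hj]
  have hderiv : ∀ (t : UnitAddTorus d) (s : ℝ),
      HasDerivAt (fun s : ℝ => g (t + torusPt (Pi.single i s))) (g' (t + torusPt (Pi.single i s))) s := by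
    intro t s
    obtain ⟨w, rfl⟩ := (isOpenQuotientMap_torusPt d).surjective t
    simp only [hpt, hg, hg']
    have h1 : HasFDerivAt G (fderiv ℝ G (w + s • Pi.single i 1)) (w + s • Pi.single i 1) :=
      (h.contDiff.differentiable (by simp) _).hasFDerivAt
    have h2 : HasDerivAt (fun s : ℝ => w + s • (Pi.single i 1 : d → ℝ)) (Pi.single i 1) s := by
      simpa using ((hasDerivAt_id s).smul_const (Pi.single i 1 : d → ℝ)).const_add w
    exact h1.comp_hasDerivAt s h2
  have hprob : IsProbabilityMeasure μ := by rw [hμ]; infer_instance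
  have hinv : μ.IsAddHaarMeasure := by rw [hμ]; infer_instance
  have hcont : ∀ (u : C(UnitAddTorus d, ℂ)) (s : ℝ), Continuous fun t => UnitAddTorus.mFourier (-k) t • u (t + torusPt (Pi.single i s)) := by
    intro u s; fun_prop
  have hint : ∀ (u : C(UnitAddTorus d, ℂ)) (s : ℝ), Integrable (fun t => UnitAddTorus.mFourier (-k) t • u (t + torusPt (Pi.single i s))) μ :=
    fun u s => (hcont u s).integrable_of_hasCompactSupport (HasCompactSupport.of_compactSpace _)
  have hnorm : ∀ t, ‖UnitAddTorus.mFourier (-k) t‖ ≤ 1 := fun t =>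
    (ContinuousMap.norm_coe_le_norm _ t).trans_eq UnitAddTorus.mFourier_norm
  have main := (hasDerivAt_integral_of_dominated_loc_of_deriv_le (μ := μ) (𝕜 := ℝ) (x₀ := (0:ℝ)) (s := Set.univ)
    (F := fun s t => UnitAddTorus.mFourier (-k) t • g (t + torusPt (Pi.single i s)))
    (F' := fun s t => UnitAddTorus.mFourier (-k) t • g' (t + torusPt (Pi.single i s)))
    (bound := fun _ => ‖g'‖) Filter.univ_mem
    (Filter.Eventually.of_forall fun s => (hint g s).aestronglyMeasurable) (hint g 0)
    (hint g' 0).aestronglyMeasurable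
    (Filter.Eventually.of_forall fun t s _ => by
      rw [norm_smul]
      calc _ ≤ 1 * ‖g'‖ := mul_le_mul (hnorm t) (ContinuousMap.norm_coe_le_norm _ _) (norm_nonneg _) zero_le_one
        _ = _ := one_mul _)
    (integrable_const _)
    (Filter.Eventually.of_forall fun t s _ => (hderiv t s).const_smul (UnitAddTorus.mFourier (-k) t))).2
  have hz : torusPt (Pi.single i (0:ℝ)) = (0 : UnitAddTorus d) := by
    funext j; simp [torusPt]
  have hshift : ∀ s : ℝ, ∫ t, UnitAddTorus.mFourier (-k) t • g (t + torusPt (Pi.single i s)) ∂μ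
      = Complex.exp (2 * Real.pi * Complex.I * k i * s) * UnitAddTorus.mFourierCoeff g k := by
    intro s
    have h3 := integral_add_right_eq_self (μ := μ) (fun t => UnitAddTorus.mFourier (-k) (t - torusPt (Pi.single i s)) • g t) (torusPt (Pi.single i s))
    simp only [add_sub_cancel_right] at h3
    rw [h3, coeff_def, ← hμ, ← integral_const_mul]
    congr 1
    funext t
    have : UnitAddTorus.mFourier (-k) (t - torusPt (Pi.single i s)) = Complex.exp (2 * Real.pi * Complex.I * k i * s) * UnitAddTorus.mFourier (-k) t := by
      obtain ⟨w, rfl⟩ := (isOpenQuotientMap_torusPt d).surjective t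
      have e1 : torusPt w - torusPt (Pi.single i s) = torusPt (w - Pi.single i s) := rfl
      rw [e1, mFourier_torusPt, mFourier_torusPt, ← Complex.exp_add]
      congr 1
      have : ∑ j, (((-k) j : ℤ) : ℂ) * (((w - Pi.single i s : d → ℝ) j : ℝ) : ℂ)
          = k i * s + ∑ j, (((-k) j : ℤ) : ℂ) * ((w j : ℝ) : ℂ) := by
        have h6 : ∀ j, (((-k) j : ℤ) : ℂ) * (((w - Pi.single i s : d → ℝ) j : ℝ) : ℂ)
            = (if j = i then (k i * s : ℂ) else 0) + (((-k) j : ℤ) : ℂ) * ((w j : ℝ) : ℂ) := by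
          intro j
          by_cases hj : j = i
          · subst hj; simp; ring
          · simp [hj]
        simp_rw [h6]
        rw [Finset.sum_add_distrib]; simp
      rw [this]; ring
    rw [this]; simp [mul_assoc]
  simp only [hshift, hz, add_zero] at main
  have h4 : HasDerivAt (fun s : ℝ => Complex.exp (2 * Real.pi * Complex.I * k i * s) * UnitAddTorus.mFourierCoeff g k)
      (2 * Real.pi * Complex.I * k i * UnitAddTorus.mFourierCoeff g k) 0 := by
    have h5 : HasDerivAt (fun s : ℝ => Complex.exp (2 * Real.pi * Complex.I * k i * s)) (2 * Real.pi * Complex.I * k i) 0 := by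
      have := ((Complex.ofRealCLM.hasDerivAt (x := (0:ℝ))).const_mul (2 * Real.pi * Complex.I * k i : ℂ)).cexp
      simpa using this
    exact h5.mul_const _
  exact main.unique h4

lemma summable_int_norm (d : Type*) [Fintype d] :
    ∃ M : ℕ, M ≠ 0 ∧ Summable fun k : d → ℤ => (‖(fun i => (k i : ℝ) : d → ℝ)‖⁻¹) ^ M := by
  classical
  let L := Submodule.span ℤ (Set.range (Pi.basisFun ℝ d))
  refine ⟨Module.finrank ℤ L + 1, by simp, ?_⟩
  have hs := ZLattice.summable_norm_pow_inv L (Module.finrank ℤ L + 1) (Nat.lt_succ_self _)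
  have hmem : ∀ k : d → ℤ, (fun i => (k i : ℝ) : d → ℝ) ∈ L := by
    intro k
    rw [Module.Basis.mem_span_iff_repr_mem]
    intro i; simp
  let e : (d → ℤ) → L := fun k => ⟨_, hmem k⟩
  have he : Function.Injective e := by
    intro k l h
    have := congrArg Subtype.val h
    funext i
    have h2 : (k i : ℝ) = l i := congrFun this i
    exact_mod_cast h2
  have h3 := hs.comp_injective he
  exact h3

lemma PeriodicSmooth.iter [DecidableEq d] {G : (d → ℝ) → ℂ} (h : PeriodicSmooth G) (i : d) (g : C(UnitAddTorus d, ℂ))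
    (hg : ∀ w, g (torusPt w) = G w) (M : ℕ) :
    ∃ B : ℝ, ∀ k : d → ℤ, ‖(k i : ℝ)‖ ^ M * ‖UnitAddTorus.mFourierCoeff g k‖ ≤ B := by
  induction M generalizing G g with
  | zero =>
    refine ⟨‖g‖, fun k => ?_⟩
    rw [pow_zero, one_mul, coeff_def]
    refine (norm_integral_le_of_norm_le_const (C := ‖g‖) (Filter.Eventually.of_forall fun t => ?_)).trans ?_
    · rw [norm_smul]
      have hn : ‖UnitAddTorus.mFourier (-k) t‖ ≤ 1 :=
        (ContinuousMap.norm_coe_le_norm _ t).trans_eq UnitAddTorus.mFourier_norm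
      calc _ ≤ 1 * ‖g‖ := mul_le_mul hn (ContinuousMap.norm_coe_le_norm _ _) (norm_nonneg _) zero_le_one
        _ = _ := one_mul _
    · simp
  | succ M ih =>
    obtain ⟨g', hg'⟩ := (h.pderiv i).desc
    obtain ⟨B, hB⟩ := ih (h.pderiv i) g' hg'
    refine ⟨B, fun k => le_trans ?_ (hB k)⟩
    rw [coeff_partialDeriv h i g g' hg hg', pow_succ, mul_assoc]
    gcongr
    simp only [norm_mul, Complex.norm_I, Complex.norm_real, Complex.norm_ofNat, mul_one]
    have e : ‖((k i : ℤ) : ℂ)‖ = ‖((k i : ℤ) : ℝ)‖ := by simp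
    rw [e]
    gcongr
    have : (1:ℝ) ≤ 2 * ‖Real.pi‖ := by
      rw [Real.norm_of_nonneg Real.pi_pos.le]; linarith [Real.pi_gt_three]
    nlinarith [norm_nonneg ((k i : ℤ) : ℝ)]

lemma PeriodicSmooth.summable {G : (d → ℝ) → ℂ} (h : PeriodicSmooth G) (g : C(UnitAddTorus d, ℂ))
    (hg : ∀ w, g (torusPt w) = G w) : Summable (UnitAddTorus.mFourierCoeff g) := by
  classical
  obtain ⟨M, hM, hs⟩ := summable_int_norm d
  choose B hB using fun i => h.iter i g hg M
  have hB0 : ∀ i, 0 ≤ B i := fun i => le_trans (by positivity) (hB i 0)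
  refine Summable.of_norm_bounded_eventually (hs.mul_left (∑ i, B i)) ?_
  rw [Filter.eventually_cofinite]
  refine (Set.finite_singleton (0 : d → ℤ)).subset fun k hk => ?_
  by_contra hk0
  apply hk
  have hk0 : k ≠ 0 := hk0
  have hne : (fun i => (k i : ℝ) : d → ℝ) ≠ 0 := by
    intro h0; apply hk0; funext i; have h2 : (k i : ℝ) = 0 := congrFun h0 i
    exact_mod_cast h2
  obtain ⟨j, hj⟩ := Function.ne_iff.1 hk0
  have : Nonempty d := ⟨j⟩
  obtain ⟨i, hi⟩ := Finite.exists_max (fun i => ‖(k i : ℝ)‖)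
  have hpos : 0 < ‖(fun i => (k i : ℝ) : d → ℝ)‖ := norm_pos_iff.2 hne
  rw [inv_pow, ← div_eq_mul_inv, le_div_iff₀ (by positivity), mul_comm]
  have hi' : ‖(fun i => (k i : ℝ) : d → ℝ)‖ ≤ ‖(k i : ℝ)‖ :=
    (pi_norm_le_iff_of_nonneg (norm_nonneg _)).2 hi
  refine (mul_le_mul_of_nonneg_right (pow_le_pow_left₀ hpos.le hi' M) (norm_nonneg _)).trans ?_
  exact (hB i k).trans (Finset.single_le_sum (fun i _ => hB0 i) (Finset.mem_univ i))

lemma PeriodicSmooth.fourier {G : (d → ℝ) → ℂ} (h : PeriodicSmooth G) : ∃ c : (d → ℤ) → ℂ, Summable (fun k => ‖c k‖) ∧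
    ∀ w, HasSum (fun k => c k * Complex.exp (2 * Real.pi * Complex.I * ∑ i, (k i : ℂ) * (w i : ℂ))) (G w) := by
  obtain ⟨g, hg⟩ := h.desc
  refine ⟨UnitAddTorus.mFourierCoeff g, (h.summable g hg).norm, fun w => ?_⟩
  have := UnitAddTorus.hasSum_mFourier_series_apply_of_summable (h.summable g hg) (torusPt w)
  simpa only [mFourier_torusPt, hg, smul_eq_mul] using this

lemma inner_intVec (l : Fin n → ℤ) (x : EuclideanSpace ℝ (Fin n)) : ⟪intVec l, x⟫ = ∑ i, (l i : ℝ) * x i := by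
  simp [intVec, PiLp.inner_apply, mul_comm]

/-- The Fourier expansion of a smooth function on the torus converges absolutely. -/
lemma IsSmoothOnTorus.fourier {f : EuclideanSpace ℝ (Fin n) × EuclideanSpace ℝ (Fin n) → ℂ} (hf : IsSmoothOnTorus f) :
    ∃ c : (Fin n ⊕ Fin n → ℤ) → ℂ, Summable (fun q => ‖c q‖) ∧ ∀ x ξ,
      HasSum (fun q => c q * exp2pi (⟪intVec (fun i => q (Sum.inl i)), x⟫ + ⟪intVec (fun i => q (Sum.inr i)), ξ⟫)) (f (x, ξ)) := by
  let G : (Fin n ⊕ Fin n → ℝ) → ℂ := fun w =>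
    f (WithLp.toLp 2 (fun i => w (Sum.inl i)), WithLp.toLp 2 (fun i => w (Sum.inr i)))
  have hG : PeriodicSmooth G := by
    refine ⟨?_, ?_⟩
    · refine hf.contDiff.comp (ContDiff.prodMk ?_ ?_)
      · exact (PiLp.contDiff_toLp).comp (contDiff_pi.2 fun i => contDiff_apply ℝ ℝ _)
      · exact (PiLp.contDiff_toLp).comp (contDiff_pi.2 fun i => contDiff_apply ℝ ℝ _)
    · intro k w
      exact hf.periodic (fun i => k (Sum.inl i)) (fun i => k (Sum.inr i))
        (WithLp.toLp 2 (fun i => w (Sum.inl i))) (WithLp.toLp 2 (fun i => w (Sum.inr i)))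
  obtain ⟨c, hc, hs⟩ := hG.fourier
  refine ⟨c, hc, fun x ξ => ?_⟩
  have := hs (Sum.elim x ξ)
  simp only [G, Sum.elim_inl, Sum.elim_inr] at this
  convert this using 3 with q
  rw [exp2pi, inner_intVec, inner_intVec]
  congr 1
  rw [Fintype.sum_sum_type]
  push_cast
  simp only [Sum.elim_inl, Sum.elim_inr]
  ring

def gridPt (N : ℕ) (k : Fin n → ℤ) : EuclideanSpace ℝ (Fin n) := WithLp.toLp 2 (fun i => (k i : ℝ) / N)

lemma summable_gridPt (N : ℕ) [NeZero N] (φ : 𝓢(EuclideanSpace ℝ (Fin n), ℂ)) : Summable fun k : Fin n → ℤ => ‖φ (gridPt N k)‖ := by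
  obtain ⟨M, hM, hs⟩ := summable_int_norm (Fin n)
  have hN : (0 : ℝ) < N := by exact_mod_cast Nat.pos_of_ne_zero (NeZero.ne N)
  obtain ⟨C, hC0, hC⟩ := φ.decay M 0
  refine Summable.of_norm_bounded_eventually (hs.mul_left ((N : ℝ) ^ M * C)) ?_
  rw [Filter.eventually_cofinite]
  refine (Set.finite_singleton (0 : Fin n → ℤ)).subset fun k hk => ?_
  by_contra hk0
  apply hk
  have hk0 : k ≠ 0 := hk0
  have hne : (fun i => (k i : ℝ) : Fin n → ℝ) ≠ 0 := by
    intro h0; apply hk0; funext i; have h2 : (k i : ℝ) = 0 := congrFun h0 i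
    exact_mod_cast h2
  have hpos : 0 < ‖(fun i => (k i : ℝ) : Fin n → ℝ)‖ := norm_pos_iff.2 hne
  rw [inv_pow, ← div_eq_mul_inv, le_div_iff₀ (by positivity), mul_comm, norm_norm]
  have h1 : ‖(fun i => (k i : ℝ) : Fin n → ℝ)‖ ≤ N * ‖(gridPt N k : EuclideanSpace ℝ (Fin n))‖ := by
    rw [pi_norm_le_iff_of_nonneg (by positivity)]
    intro i
    have := PiLp.norm_apply_le (gridPt N k) i
    simp only [gridPt, norm_div] at this
    rw [div_le_iff₀ (by simpa using hN)] at this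
    simpa [gridPt, mul_comm] using this
  have h2 := hC (gridPt N k)
  rw [norm_iteratedFDeriv_zero] at h2
  calc _ ≤ (N * ‖(gridPt N k : EuclideanSpace ℝ (Fin n))‖) ^ M * ‖φ (gridPt N k)‖ := by gcongr
    _ = N ^ M * (‖(gridPt N k : EuclideanSpace ℝ (Fin n))‖ ^ M * ‖φ (gridPt N k)‖) := by ring
    _ ≤ _ := by gcongr

/-- The factor `exp(πi(2⟨j, l⟩ - ⟨l, m⟩)/N)`. -/
def weylPhase (N : ℕ) (j : Fin n → ZMod N) (l m : Fin n → ℤ) : ℂ :=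
  exp2pi ((∑ i, (l i : ℝ) * ((j i).val : ℝ)) / N - (∑ i, (l i : ℝ) * (m i : ℝ)) / (2 * N))

lemma weylPhase_eq (N : ℕ) [NeZero N] (j : Fin n → ZMod N) (l m k : Fin n → ℤ) (hk : ∀ i, (k i : ZMod N) = j i) :
    exp2pi (⟪intVec l, gridPt N k⟫ - ⟪intVec l, (N : ℝ)⁻¹ • intVec m⟫ / 2) = weylPhase N j l m := by
  have hN : (N : ℝ) ≠ 0 := by exact_mod_cast NeZero.ne N
  have : ∀ i, ∃ r : ℤ, k i = (j i).val + N * r := by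
    intro i
    have h1 : ((k i - ((j i).val : ℤ) : ℤ) : ZMod N) = 0 := by
      push_cast; rw [hk i, ZMod.natCast_zmod_val, sub_self]
    obtain ⟨r, hr⟩ := (ZMod.intCast_zmod_eq_zero_iff_dvd _ N).1 h1
    exact ⟨r, by linarith⟩
  choose r hr using this
  have e : ⟪intVec l, (gridPt N k : EuclideanSpace ℝ (Fin n))⟫ - ⟪intVec l, (N : ℝ)⁻¹ • intVec m⟫ / 2 =
     ((∑ i, l i * r i : ℤ) : ℝ) + ((∑ i, (l i : ℝ) * ((j i).val : ℝ)) / N - (∑ i, (l i : ℝ) * (m i : ℝ)) / (2 * N)) := by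
    rw [inner_intVec, inner_intVec]
    have a1 : ∑ i, (l i : ℝ) * (gridPt N k : EuclideanSpace ℝ (Fin n)) i = ((∑ i, l i * r i : ℤ) : ℝ) + (∑ i, (l i : ℝ) * ((j i).val : ℝ)) / N := by
      push_cast
      rw [Finset.sum_div, ← Finset.sum_add_distrib]
      refine Finset.sum_congr rfl fun i _ => ?_
      simp only [gridPt]
      rw [hr i]; push_cast; field_simp; ring
    have a2 : ∑ i, (l i : ℝ) * ((N : ℝ)⁻¹ • intVec m : EuclideanSpace ℝ (Fin n)) i = (∑ i, (l i : ℝ) * (m i : ℝ)) / N := by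
      rw [Finset.sum_div]
      refine Finset.sum_congr rfl fun i _ => ?_
      simp [intVec]; ring
    rw [a1, a2]; field_simp; ring
  rw [e, exp2pi_add, exp2pi_int, one_mul, weylPhase]

def shiftEquiv (N : ℕ) (j : Fin n → ZMod N) (m : Fin n → ℤ) :
    {k : Fin n → ℤ // ∀ i, (k i : ZMod N) = j i} ≃ {k : Fin n → ℤ // ∀ i, (k i : ZMod N) = j i - m i} where
  toFun k := ⟨k.1 - m, fun i => by simp [k.2 i]⟩
  invFun k := ⟨k.1 + m, fun i => by simp [k.2 i]⟩
  left_inv k := by simp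
  right_inv k := by simp

lemma gridPt_sub (N : ℕ) (k m : Fin n → ℤ) : gridPt N (k - m) = gridPt N k - (N : ℝ)⁻¹ • intVec m := by
  ext i; simp [gridPt, intVec]; ring

theorem isQuantizationMatrix_of_hasSum (N : ℕ) [NeZero N] (f : EuclideanSpace ℝ (Fin n) × EuclideanSpace ℝ (Fin n) → ℂ)
    (c : (Fin n ⊕ Fin n → ℤ) → ℂ) (hc : Summable fun q => ‖c q‖)
    (hf : ∀ x ξ, HasSum (fun q => c q * exp2pi (⟪intVec (fun i => q (Sum.inl i)), x⟫ + ⟪intVec (fun i => q (Sum.inr i)), ξ⟫)) (f (x, ξ))) :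
    IsQuantizationMatrix f N (fun p j => ∑' q : Fin n ⊕ Fin n → ℤ,
      if (∀ i, p i = j i - (q (Sum.inr i) : ZMod N)) then
        c q * weylPhase N j (fun i => q (Sum.inl i)) (fun i => q (Sum.inr i)) else 0) := by
  classical
  intro j φ
  have hsum := summable_gridPt N φ
  set S : (Fin n → ZMod N) → ℂ := fun p => ∑' k : {k : Fin n → ℤ // ∀ i, (k i : ZMod N) = p i}, φ (gridPt N k.1) with hS
  have hcomb : ∀ p, comb N p φ = ((Real.sqrt ((N : ℝ) ^ n))⁻¹ : ℝ) * S p := fun p => rfl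
  let T : (Fin n ⊕ Fin n → ℤ) → {k : Fin n → ℤ // ∀ i, (k i : ZMod N) = j i} → ℂ := fun q k =>
    c q * weylPhase N j (fun i => q (Sum.inl i)) (fun i => q (Sum.inr i)) * φ (gridPt N (k.1 - fun i => q (Sum.inr i)))
  have hW : ∀ k : {k : Fin n → ℤ // ∀ i, (k i : ZMod N) = j i},
      weylTranspose (1 / (2 * Real.pi * N)) f φ (gridPt N k.1) = ∑' q, T q k := by
    intro k
    rw [weylTranspose_hasSum N f c _ _ hc hf]
    congr 1; funext q
    rw [weylPhase_eq N j _ _ k.1 k.2, ← gridPt_sub, ← mul_assoc]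
  have hnph : ∀ l m, ‖weylPhase N j l m‖ = 1 := fun l m => norm_exp2pi _
  have hTn : ∀ q k, ‖T q k‖ = ‖c q‖ * ‖φ (gridPt N (k.1 - fun i => q (Sum.inr i)))‖ := by
    intro q k; simp only [T, norm_mul, hnph, mul_one]
  have hinj : ∀ m : Fin n → ℤ, Function.Injective
      (fun k : {k : Fin n → ℤ // ∀ i, (k i : ZMod N) = j i} => k.1 - m) :=
    fun m a b h => Subtype.ext (sub_left_injective h)
  have hsm : ∀ m : Fin n → ℤ, Summable
      (fun k : {k : Fin n → ℤ // ∀ i, (k i : ZMod N) = j i} => ‖φ (gridPt N (k.1 - m))‖) :=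
    fun m => hsum.comp_injective (hinj m)
  have hT : Summable (Function.uncurry T) := by
    apply Summable.of_norm
    rw [summable_prod_of_nonneg (fun _ => norm_nonneg _)]
    refine ⟨fun q => ?_, ?_⟩
    · simp only [Function.uncurry, hTn]; exact (hsm _).mul_left _
    · simp only [Function.uncurry, hTn, tsum_mul_left]
      refine Summable.of_nonneg_of_le (fun q => by positivity) (fun q => ?_) (hc.mul_right (∑' k : Fin n → ℤ, ‖φ (gridPt N k)‖))
      gcongr
      exact (hsm _).tsum_le_tsum_of_inj _ (hinj _) (fun _ _ => norm_nonneg _) (fun _ => le_rfl) hsum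
  have hTk : ∀ q, ∑' k, T q k = c q * weylPhase N j (fun i => q (Sum.inl i)) (fun i => q (Sum.inr i)) *
      S (fun i => j i - (q (Sum.inr i) : ZMod N)) := by
    intro q
    simp only [T]
    rw [tsum_mul_left]
    congr 1
    rw [hS]
    exact (shiftEquiv N j (fun i => q (Sum.inr i))).tsum_eq
      (fun k : {k : Fin n → ℤ // ∀ i, (k i : ZMod N) = j i - ((q (Sum.inr i) : ℤ) : ZMod N)} => φ (gridPt N k.1))
  have hmain : ∑' k : {k : Fin n → ℤ // ∀ i, (k i : ZMod N) = j i},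
      weylTranspose (1 / (2 * Real.pi * N)) f φ (gridPt N k.1) =
      ∑ p, (∑' q : Fin n ⊕ Fin n → ℤ, if (∀ i, p i = j i - (q (Sum.inr i) : ZMod N)) then
        c q * weylPhase N j (fun i => q (Sum.inl i)) (fun i => q (Sum.inr i)) else 0) * S p := by
    simp_rw [hW]
    rw [hT.tsum_comm]
    simp_rw [hTk, ← tsum_mul_right]
    rw [← Summable.tsum_finsetSum]
    · congr 1; funext q
      rw [Finset.sum_eq_single (fun i => j i - (q (Sum.inr i) : ZMod N))]
      · simp
      · intro p _ hp
        rw [if_neg (fun h => hp (funext h)), zero_mul]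
      · simp
    · intro p _
      refine Summable.mul_right _ (Summable.of_norm_bounded hc fun q => ?_)
      split_ifs
      · rw [norm_mul, hnph, mul_one]
      · simp
  calc comb N j (weylTranspose (1 / (2 * Real.pi * N)) f φ)
      = ((Real.sqrt ((N : ℝ) ^ n))⁻¹ : ℝ) * ∑' k : {k : Fin n → ℤ // ∀ i, (k i : ZMod N) = j i},
      weylTranspose (1 / (2 * Real.pi * N)) f φ (gridPt N k.1) := rfl
    _ = _ := by
      rw [hmain, Finset.mul_sum]
      refine Finset.sum_congr rfl fun p _ => ?_
      rw [hcomb]; ring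

theorem exists_test_function (N : ℕ) [NeZero N] (p : Fin n → ZMod N) : ∃ φ : 𝓢(EuclideanSpace ℝ (Fin n), ℂ),
    comb N p φ ≠ 0 ∧ ∀ m, m ≠ p → comb N m φ = 0 := by
  have hN : (0 : ℝ) < N := by exact_mod_cast Nat.pos_of_ne_zero (NeZero.ne N)
  let k₀ : Fin n → ℤ := fun i => (p i).val
  have hk₀ : ∀ i, (k₀ i : ZMod N) = p i := fun i => by simp [k₀]
  let b : ContDiffBump (gridPt N k₀ : EuclideanSpace ℝ (Fin n)) := ⟨1 / (4 * N), 1 / (2 * N), by positivity, by gcongr; norm_num⟩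
  have hsupp : HasCompactSupport (fun x => ((b x : ℝ) : ℂ)) :=
    b.hasCompactSupport.comp_left (g := fun t : ℝ => (t : ℂ)) (by simp)
  have hsmooth : ContDiff ℝ ∞ (fun x => ((b x : ℝ) : ℂ)) := Complex.ofRealCLM.contDiff.comp b.contDiff
  have hzero : ∀ k : Fin n → ℤ, k ≠ k₀ → b (gridPt N k) = 0 := by
    intro k hk
    apply b.zero_of_le_dist
    obtain ⟨i, hi⟩ := Function.ne_iff.1 hk
    have h1 := PiLp.norm_apply_le (gridPt N k - gridPt N k₀ : EuclideanSpace ℝ (Fin n)) i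
    rw [dist_eq_norm]
    refine le_trans ?_ h1
    have h2 : (gridPt N k - gridPt N k₀ : EuclideanSpace ℝ (Fin n)) i = ((k i - k₀ i : ℤ) : ℝ) / N := by
      simp [gridPt]; ring
    rw [h2, norm_div, Real.norm_of_nonneg hN.le]
    have h3 : (1 : ℝ) ≤ ‖((k i - k₀ i : ℤ) : ℝ)‖ := by
      rw [Real.norm_eq_abs, ← Int.cast_abs]
      exact_mod_cast Int.one_le_abs (sub_ne_zero.2 hi)
    show 1 / (2 * (N : ℝ)) ≤ _
    rw [div_le_div_iff₀ (by positivity) hN]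
    nlinarith
  refine ⟨hsupp.toSchwartzMap hsmooth, ?_, ?_⟩
  · have : comb N p (hsupp.toSchwartzMap hsmooth) = ((Real.sqrt ((N : ℝ) ^ n))⁻¹ : ℝ) *
        ∑' k : {k : Fin n → ℤ // ∀ i, (k i : ZMod N) = p i}, ((b (gridPt N k.1) : ℝ) : ℂ) := rfl
    rw [this, tsum_eq_single ⟨k₀, hk₀⟩]
    · rw [b.one_of_mem_closedBall (Metric.mem_closedBall_self b.rIn_pos.le)]
      have : Real.sqrt ((N : ℝ) ^ n) ≠ 0 := (Real.sqrt_pos.2 (by positivity)).ne'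
      simpa using this
    · intro k hk
      rw [hzero k.1 (fun h => hk (Subtype.ext h))]; simp
  · intro m hm
    have : comb N m (hsupp.toSchwartzMap hsmooth) = ((Real.sqrt ((N : ℝ) ^ n))⁻¹ : ℝ) *
        ∑' k : {k : Fin n → ℤ // ∀ i, (k i : ZMod N) = m i}, ((b (gridPt N k.1) : ℝ) : ℂ) := rfl
    rw [this]
    have hz : ∀ k : {k : Fin n → ℤ // ∀ i, (k i : ZMod N) = m i}, ((b (gridPt N k.1) : ℝ) : ℂ) = 0 := by
      intro k
      rw [hzero k.1 (fun h => hm (funext fun i => by rw [← k.2 i, h, hk₀ i]))]; simp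
    simp [hz]

theorem IsQuantizationMatrix.unique {N : ℕ} [NeZero N] {f : EuclideanSpace ℝ (Fin n) × EuclideanSpace ℝ (Fin n) → ℂ}
    {F F' : Matrix (Fin n → ZMod N) (Fin n → ZMod N) ℂ}
    (h : IsQuantizationMatrix f N F) (h' : IsQuantizationMatrix f N F') : F = F' := by
  ext p j
  obtain ⟨φ, h1, h2⟩ := exists_test_function N p
  have h3 := (h j φ).symm.trans (h' j φ)
  rw [Finset.sum_eq_single p (fun m _ hm => by rw [h2 m hm, mul_zero]) (by simp),
    Finset.sum_eq_single p (fun m _ hm => by rw [h2 m hm, mul_zero]) (by simp)] at h3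
  exact mul_right_cancel₀ h1 h3

theorem existsUnique_isQuantizationMatrix {f : EuclideanSpace ℝ (Fin n) × EuclideanSpace ℝ (Fin n) → ℂ} (hf : IsSmoothOnTorus f)
    (N : ℕ) [NeZero N] : ∃! F, IsQuantizationMatrix f N F := by
  obtain ⟨c, hc, hs⟩ := hf.fourier
  exact ⟨_, isQuantizationMatrix_of_hasSum N f c hc hs, fun _ h => h.unique (isQuantizationMatrix_of_hasSum N f c hc hs)⟩

theorem quantize_spec {f : EuclideanSpace ℝ (Fin n) × EuclideanSpace ℝ (Fin n) → ℂ} (hf : IsSmoothOnTorus f)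
    (N : ℕ) [NeZero N] : IsQuantizationMatrix f N (quantize f N) := by
  have h := (existsUnique_isQuantizationMatrix hf N).exists
  rw [quantize, dif_pos h]
  exact h.choose_spec

/-- The explicit form of the matrix `f_N` in terms of the Fourier coefficients of `f`. -/
theorem quantize_eq_of_hasSum (N : ℕ) [NeZero N]
    (f : EuclideanSpace ℝ (Fin n) × EuclideanSpace ℝ (Fin n) → ℂ)
    (c : (Fin n ⊕ Fin n → ℤ) → ℂ) (hc : Summable fun q => ‖c q‖)
    (hf : ∀ x ξ, HasSum (fun q => c q * exp2pi (⟪intVec (fun i => q (Sum.inl i)), x⟫ +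
      ⟪intVec (fun i => q (Sum.inr i)), ξ⟫)) (f (x, ξ))) :
    quantize f N = fun p j => ∑' q : Fin n ⊕ Fin n → ℤ,
      if (∀ i, p i = j i - (q (Sum.inr i) : ZMod N)) then
        c q * weylPhase N j (fun i => q (Sum.inl i)) (fun i => q (Sum.inr i)) else 0 := by
  have h0 := isQuantizationMatrix_of_hasSum N f c hc hf
  have h : ∃ F, IsQuantizationMatrix f N F := ⟨_, h0⟩
  rw [quantize, dif_pos h]
  exact h.choose_spec.unique h0

end WellDefined

end TorusQuantization

end

/-!
Expanding `f` in a Fourier series writes `f_N` as a rapidly convergent sum `∑ c_q W_q` of Weyl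
translations. Since `W_q W_r^* = exp(πi σ(q, r)/N) W_{q-r}`, the matrix `f_N f_N^*` is the sum of
`c_q (conj c_r) exp(πi σ(q, r)/N) W_{q-r}`. The anti-Wick quantization of `|f|²` is the same sum
with the phase replaced by the complex conjugate of the expectation of `W_{q-r}` in the coherent
state. For a coherent state localized at the scale `√N` in position and in frequency both factors
are `1 + O(1/N)`, with constants polynomial in `q` and `r`, so `f_N f_N^*` is the anti-Wick
quantization of `|f|²` up to `O(1/N)`.

An eigenvector of `f_N f_N^*` with eigenvalue at most `R α²` thus has anti-Wick energy at most
`(R + D) α²`, so at least half of its mass in phase space lies over the grid points where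
`|f|² ≤ 2 (R + D) α²`. Summing over an orthonormal family of eigenvectors, Bessel's inequality for
each coherent state bounds their number by `2 N^{-n}` times the number of such grid points. The
cells of side `1/N` at these points are disjoint and `f` is Lipschitz, so their number is at most
`N^{2n}` times the volume of a slightly larger sublevel set.
-/

open scoped ComplexConjugate

noncomputable section

namespace TorusQuantization

section Localization

variable {ι : Type*}

/-- The reduction modulo `N` of an integer vector. -/
def modVec (N : ℕ) (l : ι → ℤ) : ι → ZMod N := fun i => l i

/-- The representative of a vector modulo `N` with entries in `(-N/2, N/2]`. -/
def minRep {N : ℕ} (y : ι → ZMod N) : ι → ℤ := fun i => (y i).valMinAbs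

lemma modVec_minRep {N : ℕ} (y : ι → ZMod N) : modVec N (minRep y) = y :=
  funext fun i => (y i).coe_valMinAbs

lemma minRep_injective {N : ℕ} : Function.Injective (minRep : (ι → ZMod N) → ι → ℤ) :=
  Function.LeftInverse.injective modVec_minRep

lemma minRep_natCast {N : ℕ} {y : ι → ℕ} (hy : ∀ i, 2 * y i ≤ N) :
    minRep (fun i => (y i : ZMod N)) = fun i => (y i : ℤ) :=
  funext fun i => ZMod.valMinAbs_natCast_of_le_half (by have := hy i; omega)

variable [Fintype ι]

lemma norm_minRep_neg {N : ℕ} (y : ι → ZMod N) : ‖minRep (-y)‖ = ‖minRep y‖ := by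
  simp only [Pi.norm_def, minRep, ← NNReal.natCast_natAbs, Pi.neg_apply,
    ZMod.natAbs_valMinAbs_neg]

lemma norm_minRep_add_le {N : ℕ} (y z : ι → ZMod N) :
    ‖minRep (y + z)‖ ≤ ‖minRep y‖ + ‖minRep z‖ := by
  refine (pi_norm_le_iff_of_nonneg (by positivity)).2 fun i => ?_
  calc ‖minRep (y + z) i‖ ≤ ‖minRep y i + minRep z i‖ := by
        simp only [Int.norm_eq_abs, ← Int.cast_abs, Int.abs_eq_natAbs]
        exact_mod_cast ZMod.natAbs_valMinAbs_add_le (y i) (z i)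
    _ ≤ ‖minRep y‖ + ‖minRep z‖ :=
        (norm_add_le _ _).trans (add_le_add (norm_le_pi_norm _ i) (norm_le_pi_norm _ i))

/-- The tent function of height and half-width `s` on `(ℤ/N)ⁿ`, centred at `0`. -/
def tent {N : ℕ} (s : ℕ) (y : ι → ZMod N) : ℝ := max 0 (s - ‖minRep y‖)

lemma half_le_tent_natCast {N s : ℕ} (hs : s ≤ N) {y : ι → ℕ} (hy : ∀ i, 2 * y i ≤ s) :
    (s : ℝ) / 2 ≤ tent s (fun i => (y i : ZMod N)) := by
  have hnorm : ‖minRep fun i => (y i : ZMod N)‖ ≤ s / 2 := by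
    refine (pi_norm_le_iff_of_nonneg (by positivity)).2 fun i => ?_
    rw [minRep_natCast fun i => (hy i).trans hs, Int.norm_natCast, le_div_iff₀' two_pos]
    exact_mod_cast hy i
  exact le_max_of_le_right (by linarith)

lemma norm_minRep_lt_of_tent_ne_zero {N s : ℕ} {y : ι → ZMod N} (h : tent s y ≠ 0) :
    ‖minRep y‖ < s := by
  contrapose! h
  exact max_eq_left (sub_nonpos.2 h)

section Tent

variable {N : ℕ} [NeZero N]

lemma norm_minRep_modVec_le (l : ι → ℤ) : ‖minRep (modVec N l)‖ ≤ ‖l‖ := by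
  refine (pi_norm_le_iff_of_nonneg (norm_nonneg _)).2 fun i => le_trans ?_ (norm_le_pi_norm l i)
  simp only [Int.norm_eq_abs, ← Int.cast_abs, Int.abs_eq_natAbs]
  exact_mod_cast ZMod.natAbs_min_of_le_div_two N _ _ (ZMod.coe_valMinAbs _)
    (ZMod.natAbs_valMinAbs_le _)

lemma abs_tent_sub_le (s : ℕ) (y : ι → ZMod N) (m : ι → ℤ) :
    |tent s y - tent s (y - modVec N m)| ≤ ‖m‖ := by
  have hm : ‖minRep (modVec N m)‖ ≤ ‖m‖ := norm_minRep_modVec_le m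
  have hle : ‖minRep y‖ ≤ ‖minRep (y - modVec N m)‖ + ‖minRep (modVec N m)‖ := by
    simpa only [sub_add_cancel] using norm_minRep_add_le (y - modVec N m) (modVec N m)
  have hge : ‖minRep (y - modVec N m)‖ ≤ ‖minRep y‖ + ‖minRep (modVec N m)‖ := by
    simpa only [← sub_eq_add_neg, norm_minRep_neg] using norm_minRep_add_le y (-modVec N m)
  rw [tent, tent, max_comm, max_comm 0]
  refine (abs_max_sub_max_le_abs _ _ _).trans (abs_le.2 ?_)
  constructor <;> linarith

variable [DecidableEq ι]

lemma card_tent_ne_zero_le (s : ℕ) :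
    (Finset.univ.filter fun y : ι → ZMod N => tent s y ≠ 0).card ≤ (2 * s) ^ Fintype.card ι := by
  calc (Finset.univ.filter fun y : ι → ZMod N => tent s y ≠ 0).card
      ≤ (Fintype.piFinset fun _ : ι => Finset.Ioo (-(s : ℤ)) s).card := by
        refine Finset.card_le_card_of_injOn minRep (fun y hy => ?_) minRep_injective.injOn
        refine Fintype.mem_piFinset.2 fun i => Finset.mem_Ioo.2 (abs_lt.1 ?_)
        have h := (norm_le_pi_norm (minRep y) i).trans_lt
          (norm_minRep_lt_of_tent_ne_zero (Finset.mem_filter.1 hy).2)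
        rw [Int.norm_eq_abs] at h
        exact_mod_cast h
    _ = (2 * s - 1) ^ Fintype.card ι := by
        rw [Fintype.card_piFinset, Finset.prod_const, Int.card_Ioo, Finset.card_univ]
        congr 1
        omega
    _ ≤ (2 * s) ^ Fintype.card ι := by gcongr; omega

lemma sum_sq_tent_sub_le (s : ℕ) (m : ι → ℤ) :
    ∑ y : ι → ZMod N, (tent s y - tent s (y - modVec N m)) ^ 2 ≤
      2 * (2 * s) ^ Fintype.card ι * ‖m‖ ^ 2 := by
  set g : (ι → ZMod N) → ℝ := fun y => if tent s y ≠ 0 then ‖m‖ ^ 2 else 0 with hg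
  have hg0 : ∀ y, 0 ≤ g y := fun y => by simp only [hg]; split_ifs <;> positivity
  have hle : ∀ y, (tent s y - tent s (y - modVec N m)) ^ 2 ≤ g y + g (y - modVec N m) := by
    intro y
    have hm : (tent s y - tent s (y - modVec N m)) ^ 2 ≤ ‖m‖ ^ 2 :=
      sq_le_sq.2 ((abs_tent_sub_le s y m).trans (le_abs_self _))
    by_cases h : tent s y ≠ 0
    · exact hm.trans_eq (if_pos h).symm |>.trans (le_add_of_nonneg_right (hg0 _))
    by_cases h' : tent s (y - modVec N m) ≠ 0
    · exact hm.trans_eq (if_pos h').symm |>.trans (le_add_of_nonneg_left (hg0 _))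
    · rw [not_not.1 h, not_not.1 h', sub_zero, zero_pow two_ne_zero]
      exact add_nonneg (hg0 _) (hg0 _)
  have hsum : ∑ y, g y ≤ (2 * s) ^ Fintype.card ι * ‖m‖ ^ 2 := by
    rw [← Finset.sum_filter, Finset.sum_const, nsmul_eq_mul]
    gcongr
    exact_mod_cast card_tent_ne_zero_le s
  calc ∑ y : ι → ZMod N, (tent s y - tent s (y - modVec N m)) ^ 2
      ≤ ∑ y, g y + ∑ y, g (y - modVec N m) := by
        rw [← Finset.sum_add_distrib]
        exact Finset.sum_le_sum fun y _ => hle y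
    _ = ∑ y, g y + ∑ y, g y := by rw [← Equiv.sum_comp (Equiv.subRight (modVec N m)) g]; rfl
    _ ≤ 2 * (2 * s) ^ Fintype.card ι * ‖m‖ ^ 2 := by linarith

lemma half_pow_le_sum_sq_tent {s : ℕ} (hs : s ≤ N) :
    ((s : ℝ) / 2) ^ (Fintype.card ι + 2) ≤ ∑ y : ι → ZMod N, tent s y ^ 2 := by
  set A : Finset (ι → ℕ) := Fintype.piFinset fun _ => Finset.range (s / 2 + 1) with hA
  set cast : (ι → ℕ) → ι → ZMod N := fun y i => (y i : ZMod N)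
  have hlt : ∀ y ∈ A, ∀ i, 2 * y i ≤ s := fun y hy i => by
    have := Finset.mem_range.1 (Fintype.mem_piFinset.1 hy i)
    omega
  have hinj : Set.InjOn cast A := fun y hy z hz hyz => funext fun i => by
    have h := congrFun (congrArg minRep hyz) i
    rw [minRep_natCast fun i => (hlt y hy i).trans hs,
      minRep_natCast fun i => (hlt z hz i).trans hs] at h
    exact Nat.cast_injective (R := ℤ) h
  have hcard : ((s : ℝ) / 2) ^ Fintype.card ι ≤ A.card := by
    rw [hA, Fintype.card_piFinset, Finset.prod_const, Finset.card_range, Finset.card_univ,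
      Nat.cast_pow]
    gcongr
    rw [div_le_iff₀ two_pos]
    exact_mod_cast (by omega : s ≤ (s / 2 + 1) * 2)
  calc ((s : ℝ) / 2) ^ (Fintype.card ι + 2)
      = (s / 2) ^ Fintype.card ι * (s / 2) ^ 2 := pow_add _ _ _
    _ ≤ A.card * (s / 2) ^ 2 := by gcongr
    _ ≤ ∑ y ∈ A, tent s (cast y) ^ 2 := by
        rw [← nsmul_eq_mul]
        exact Finset.card_nsmul_le_sum _ _ _ fun y hy =>
          pow_le_pow_left₀ (by positivity) (half_le_tent_natCast hs (hlt y hy)) 2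
    _ = ∑ y ∈ A.image cast, tent s y ^ 2 := by rw [Finset.sum_image hinj]
    _ ≤ ∑ y : ι → ZMod N, tent s y ^ 2 :=
        Finset.sum_le_univ_sum_of_nonneg fun _ => sq_nonneg _

end Tent

/-- An even unit vector on `(ℤ/N)ⁿ` which lives in `|y| ≤ √N` and varies at the scale `√N`, up to
the constant `C`. -/
structure IsLocalized {N : ℕ} [NeZero N] [DecidableEq ι] (C : ℝ) (φ : (ι → ZMod N) → ℝ) : Prop where
  even : ∀ y, φ (-y) = φ y
  sum_sq : ∑ y, φ y ^ 2 = 1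
  sum_sq_sub_shift_le : ∀ m : ι → ℤ, ∑ y, (φ y - φ (y - modVec N m)) ^ 2 ≤ C * ‖m‖ ^ 2 / N
  sq_norm_minRep_le : ∀ y, φ y ≠ 0 → ‖minRep y‖ ^ 2 ≤ N

lemma exists_isLocalized (ι : Type*) [Fintype ι] [DecidableEq ι] (N : ℕ) [NeZero N] :
    ∃ φ : (ι → ZMod N) → ℝ, IsLocalized (32 * 4 ^ Fintype.card ι) φ := by
  set d := Fintype.card ι
  set s := N.sqrt
  have hN : (0 : ℝ) < N := Nat.cast_pos.2 (NeZero.pos N)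
  have hs : 0 < s := Nat.sqrt_pos.2 (NeZero.pos N)
  have hNs : (N : ℝ) ≤ 4 * (s : ℝ) ^ 2 := by
    have h : N < (s + 1) ^ 2 := Nat.lt_succ_sqrt' N
    exact_mod_cast (by nlinarith : N ≤ 4 * s ^ 2)
  set T := ∑ y : ι → ZMod N, tent s y ^ 2
  have hT : ((s : ℝ) / 2) ^ (d + 2) ≤ T := half_pow_le_sum_sq_tent (Nat.sqrt_le_self N)
  have hT0 : 0 < T := lt_of_lt_of_le (by positivity) hT
  refine ⟨fun y => tent s y / √T, fun y => ?_, ?_, fun m => ?_, fun y hy => ?_⟩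
  · rw [tent, norm_minRep_neg, ← tent]
  · simp only [div_pow, Real.sq_sqrt hT0.le, ← Finset.sum_div]
    exact div_self hT0.ne'
  · simp only [← sub_div, div_pow, Real.sq_sqrt hT0.le, ← Finset.sum_div]
    calc (∑ y : ι → ZMod N, (tent s y - tent s (y - modVec N m)) ^ 2) / T
        ≤ 2 * (2 * s) ^ d * ‖m‖ ^ 2 / ((s : ℝ) / 2) ^ (d + 2) := by
          gcongr; exact sum_sq_tent_sub_le s m
      _ = 32 * 4 ^ d * ‖m‖ ^ 2 / (4 * (s : ℝ) ^ 2) := by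
          rw [show (4 : ℝ) = 2 * 2 by norm_num, mul_pow, mul_pow, div_pow, pow_add, pow_add]
          field_simp
          ring
      _ ≤ 32 * 4 ^ d * ‖m‖ ^ 2 / N := by gcongr
  · have hy' := norm_minRep_lt_of_tent_ne_zero (left_ne_zero_of_mul hy)
    calc ‖minRep y‖ ^ 2 ≤ (s : ℝ) ^ 2 := by gcongr
      _ ≤ (N : ℝ) := by exact_mod_cast Nat.sqrt_le' N

end Localization

/-! ### Characters and ambiguity functions -/

lemma modVec_sub {ι : Type*} {N : ℕ} (l m : ι → ℤ) :
    modVec N (l - m) = modVec N l - modVec N m := by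
  ext i
  simp only [modVec, Pi.sub_apply, Int.cast_sub]

lemma modVec_dotProduct {ι : Type*} [Fintype ι] {N : ℕ} (l m : ι → ℤ) :
    modVec N l ⬝ᵥ modVec N m = ((l ⬝ᵥ m : ℤ) : ZMod N) := by
  simp only [dotProduct, modVec, Int.cast_sum, Int.cast_mul]

lemma abs_dotProduct_le {ι : Type*} [Fintype ι] (l m : ι → ℤ) :
    |((l ⬝ᵥ m : ℤ) : ℝ)| ≤ Fintype.card ι * (‖l‖ * ‖m‖) := by
  rw [← Int.norm_eq_abs, ← nsmul_eq_mul, ← Finset.card_univ]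
  refine norm_sum_le_of_le _ (fun i _ => ?_) |>.trans_eq (Finset.sum_const _)
  rw [norm_mul]
  gcongr <;> exact norm_le_pi_norm _ i

lemma conj_exp2pi (t : ℝ) : conj (exp2pi t) = exp2pi (-t) := by
  rw [exp2pi, exp2pi, ← Complex.exp_conj, map_mul, Complex.conj_ofReal, Complex.conj_I]
  congr 1
  push_cast
  ring

lemma exp2pi_re (t : ℝ) : (exp2pi t).re = Real.cos (2 * Real.pi * t) :=
  Complex.exp_ofReal_mul_I_re _

lemma norm_exp2pi_sub_one_le (t : ℝ) : ‖exp2pi t - 1‖ ≤ 2 * Real.pi * |t| := by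
  have h := Real.norm_exp_I_mul_ofReal_sub_one_le (x := 2 * Real.pi * t)
  rwa [mul_comm Complex.I, Real.norm_eq_abs, abs_mul, abs_of_pos Real.two_pi_pos] at h

lemma stdAddChar_intCast {N : ℕ} [NeZero N] (k : ℤ) :
    ZMod.stdAddChar (k : ZMod N) = exp2pi (k / N) := by
  rw [ZMod.stdAddChar_coe, exp2pi]
  congr 1
  push_cast
  ring

section Ambiguity

variable {ι : Type*} [Fintype ι] {N : ℕ} [NeZero N]

/-- The character `exp(2πi⟨x, y⟩/N)` of `(ℤ/N)ⁿ`. -/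
def pairing (x y : ι → ZMod N) : ℂ := ZMod.stdAddChar (x ⬝ᵥ y)

lemma pairing_comm (x y : ι → ZMod N) : pairing x y = pairing y x := by
  rw [pairing, dotProduct_comm, pairing]

lemma pairing_add_right (x y z : ι → ZMod N) : pairing x (y + z) = pairing x y * pairing x z := by
  rw [pairing, dotProduct_add, AddChar.map_add_eq_mul, pairing, pairing]

lemma pairing_zero_left (y : ι → ZMod N) : pairing 0 y = 1 := by
  rw [pairing, zero_dotProduct, AddChar.map_zero_eq_one]

lemma norm_pairing (x y : ι → ZMod N) : ‖pairing x y‖ = 1 := AddChar.norm_apply _ _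

lemma conj_pairing (x y : ι → ZMod N) : conj (pairing x y) = pairing x (-y) := by
  rw [pairing, pairing, dotProduct_neg, AddChar.map_neg_eq_conj]

lemma pairing_modVec (l m : ι → ℤ) :
    pairing (modVec N l) (modVec N m) = exp2pi ((l ⬝ᵥ m : ℤ) / N) := by
  rw [pairing, modVec_dotProduct, stdAddChar_intCast]

variable [DecidableEq ι]

lemma sum_pairing (z : ι → ZMod N) :
    ∑ ξ, pairing ξ z = if z = 0 then (N : ℂ) ^ Fintype.card ι else 0 := by
  have hprod : ∀ ξ, pairing ξ z = ∏ i, ZMod.stdAddChar (ξ i * z i) := fun ξ =>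
    (congrArg _ (ofAdd_sum Finset.univ fun i => ξ i * z i)).trans
      (map_prod (ZMod.stdAddChar (N := N)).toMonoidHom _ _)
  simp only [hprod]
  rw [← Fintype.prod_sum fun i (x : ZMod N) => ZMod.stdAddChar (x * z i)]
  simp only [AddChar.sum_mulShift _ (ZMod.isPrimitive_stdAddChar N), ZMod.card]
  split_ifs with h
  · simp only [h, Pi.zero_apply, if_true, Finset.prod_const, Finset.card_univ]
  · obtain ⟨i, hi⟩ := Function.ne_iff.1 h
    exact Finset.prod_eq_zero (Finset.mem_univ i) (by rw [if_neg (by exact hi), Nat.cast_zero])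

/-- The discrete ambiguity function of `v`. -/
def ambiguity (v : (ι → ZMod N) → ℂ) (l m : ι → ZMod N) : ℂ :=
  ∑ j, pairing l j * (conj (v (j - m)) * v j)

lemma norm_ambiguity_le (v : (ι → ZMod N) → ℂ) (l m : ι → ZMod N) :
    ‖ambiguity v l m‖ ≤ ∑ j, ‖v j‖ ^ 2 := by
  calc ‖ambiguity v l m‖ ≤ ∑ j, (‖v (j - m)‖ ^ 2 + ‖v j‖ ^ 2) / 2 := by
        refine norm_sum_le_of_le _ fun j _ => ?_
        rw [norm_mul, norm_pairing, one_mul, norm_mul, RCLike.norm_conj]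
        linarith [two_mul_le_add_sq ‖v (j - m)‖ ‖v j‖]
    _ = (∑ j, ‖v j‖ ^ 2 + ∑ j, ‖v j‖ ^ 2) / 2 := by
        rw [← Finset.sum_div, Finset.sum_add_distrib]
        congr 2
        exact Equiv.sum_comp (Equiv.subRight m) fun j => ‖v j‖ ^ 2
    _ = ∑ j, ‖v j‖ ^ 2 := add_self_div_two _

lemma ambiguity_zero (v : (ι → ZMod N) → ℂ) : ambiguity v 0 0 = ((∑ j, ‖v j‖ ^ 2 : ℝ) : ℂ) := by
  simp only [ambiguity, pairing_zero_left, sub_zero, one_mul, Complex.conj_mul', Complex.ofReal_sum,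
    Complex.ofReal_pow]

/-- The expectation `⟨W v, v⟩` of the Weyl translation `W` with integer frequencies `(l, m)`: the
ambiguity function in the symmetric normalization of the phase. -/
def weylExpect (v : (ι → ZMod N) → ℂ) (l m : ι → ℤ) : ℂ :=
  exp2pi (-((l ⬝ᵥ m : ℤ) / (2 * N))) * ambiguity v (modVec N l) (modVec N m)

lemma norm_weylExpect_le (v : (ι → ZMod N) → ℂ) (l m : ι → ℤ) :
    ‖weylExpect v l m‖ ≤ ∑ j, ‖v j‖ ^ 2 := by
  rw [weylExpect, norm_mul, norm_exp2pi, one_mul]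
  exact norm_ambiguity_le v _ _

end Ambiguity

lemma abs_half_sq_add_sq_sub_le {a b c B : ℝ} (hB : 0 ≤ B) (hc : c ≤ 1) (hb : b ≠ 0 → 1 - c ≤ B) :
    |(a ^ 2 + b ^ 2) / 2 - a * b * c| ≤ (b - a) ^ 2 / 2 + (a ^ 2 + b ^ 2) / 2 * B := by
  have hphase : |a * b * (1 - c)| ≤ (a ^ 2 + b ^ 2) / 2 * B := by
    obtain rfl | hb0 := eq_or_ne b 0
    · rw [mul_zero, zero_mul, abs_zero]
      positivity
    have hab : |a * b| ≤ (a ^ 2 + b ^ 2) / 2 := by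
      rw [abs_le]
      constructor <;> nlinarith [sq_nonneg (a - b), sq_nonneg (a + b)]
    rw [abs_mul, abs_of_nonneg (sub_nonneg.2 hc)]
    gcongr
    exact hb hb0
  calc |(a ^ 2 + b ^ 2) / 2 - a * b * c|
      = |(b - a) ^ 2 / 2 + a * b * (1 - c)| := by congr 1; ring
    _ ≤ |(b - a) ^ 2 / 2| + |a * b * (1 - c)| := abs_add_le _ _
    _ ≤ (b - a) ^ 2 / 2 + (a ^ 2 + b ^ 2) / 2 * B := by
        rw [abs_of_nonneg (by positivity : 0 ≤ (b - a) ^ 2 / 2)]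
        gcongr

namespace IsLocalized

variable {ι : Type*} [Fintype ι] [DecidableEq ι] {N : ℕ} [NeZero N] {C : ℝ} {φ : (ι → ZMod N) → ℝ}

lemma conj_weylExpect (hφ : IsLocalized C φ) (l m : ι → ℤ) :
    conj (weylExpect (fun j => (φ j : ℂ)) l m) = weylExpect (fun j => (φ j : ℂ)) l m := by
  have hreflect : conj (ambiguity (fun j => (φ j : ℂ)) (modVec N l) (modVec N m)) =
      pairing (modVec N l) (-modVec N m) *
        ambiguity (fun j => (φ j : ℂ)) (modVec N l) (modVec N m) := by
    rw [ambiguity, map_sum, Finset.mul_sum, ← Equiv.sum_comp (Equiv.subLeft (modVec N m))]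
    refine Finset.sum_congr rfl fun y _ => ?_
    have h₁ : φ (modVec N m - y - modVec N m) = φ y := by rw [← hφ.even]; congr 1; abel
    have h₂ : φ (modVec N m - y) = φ (y - modVec N m) := by rw [← hφ.even, neg_sub]
    rw [Equiv.subLeft_apply, map_mul, map_mul, conj_pairing, Complex.conj_ofReal,
      Complex.conj_ofReal, h₁, h₂, neg_sub, sub_eq_neg_add, pairing_add_right]
    ring
  rw [weylExpect, map_mul, hreflect, ← conj_pairing, pairing_modVec, conj_exp2pi, conj_exp2pi,
    ← mul_assoc, ← exp2pi_add]
  congr 2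
  ring

lemma weylExpect_eq_sum_cos (hφ : IsLocalized C φ) (l m : ι → ℤ) :
    weylExpect (fun j => (φ j : ℂ)) l m = ((∑ y, φ (y - modVec N m) * φ y *
      Real.cos (2 * Real.pi * ((l ⬝ᵥ (2 • minRep y - m) : ℤ) / (2 * N))) : ℝ) : ℂ) := by
  rw [← Complex.conj_eq_iff_re.1 (hφ.conj_weylExpect l m)]
  congr 1
  rw [weylExpect, ambiguity, Finset.mul_sum, Complex.re_sum]
  refine Finset.sum_congr rfl fun y _ => ?_
  nth_rewrite 1 [← modVec_minRep y]
  rw [pairing_modVec, Complex.conj_ofReal, ← mul_assoc, ← exp2pi_add, ← Complex.ofReal_mul,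
    Complex.re_mul_ofReal, exp2pi_re, mul_comm]
  congr 3
  rw [dotProduct_sub, two_nsmul, dotProduct_add]
  push_cast
  field_simp
  ring

/-- The phase of a Weyl translation varies slowly on the support of `φ`. -/
lemma one_sub_cos_le (hφ : IsLocalized C φ) (l m : ι → ℤ) {y : ι → ZMod N} (hy : φ y ≠ 0) :
    1 - Real.cos (2 * Real.pi * ((l ⬝ᵥ (2 • minRep y - m) : ℤ) / (2 * N))) ≤
      40 * (Fintype.card ι * ‖l‖) ^ 2 * (1 + ‖m‖ ^ 2) / N := by
  have hN : (1 : ℝ) ≤ N := Nat.one_le_cast.2 NeZero.one_le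
  set k : ℝ := ((l ⬝ᵥ (2 • minRep y - m) : ℤ) : ℝ)
  have hshift : ‖2 • minRep y - m‖ ^ 2 ≤ 8 * (1 + ‖m‖ ^ 2) * N := by
    have hm : ‖m‖ ^ 2 ≤ ‖m‖ ^ 2 * N := le_mul_of_one_le_right (sq_nonneg _) hN
    have htri : ‖2 • minRep y - m‖ ≤ 2 * ‖minRep y‖ + ‖m‖ :=
      (norm_sub_le _ _).trans (by rw [two_smul, two_mul]; gcongr; exact norm_add_le _ _)
    nlinarith [hφ.sq_norm_minRep_le y hy, sq_nonneg (2 * ‖minRep y‖ - ‖m‖),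
      pow_le_pow_left₀ (norm_nonneg _) htri 2]
  have hksq : k ^ 2 ≤ (Fintype.card ι * ‖l‖) ^ 2 * (8 * (1 + ‖m‖ ^ 2) * N) := by
    calc k ^ 2 = |k| ^ 2 := (sq_abs k).symm
      _ ≤ (Fintype.card ι * (‖l‖ * ‖2 • minRep y - m‖)) ^ 2 := by
          gcongr; exact abs_dotProduct_le l _
      _ = (Fintype.card ι * ‖l‖) ^ 2 * ‖2 • minRep y - m‖ ^ 2 := by ring
      _ ≤ _ := by gcongr
  have hpi : Real.pi ^ 2 ≤ 10 := by nlinarith [Real.pi_lt_d2, Real.pi_pos]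
  calc 1 - Real.cos (2 * Real.pi * (k / (2 * N)))
      ≤ (2 * Real.pi * (k / (2 * N))) ^ 2 / 2 := by
        linarith [Real.one_sub_sq_div_two_le_cos (x := 2 * Real.pi * (k / (2 * N)))]
    _ = Real.pi ^ 2 * k ^ 2 / (2 * N ^ 2) := by field_simp
    _ ≤ 10 * ((Fintype.card ι * ‖l‖) ^ 2 * (8 * (1 + ‖m‖ ^ 2) * N)) / (2 * N ^ 2) := by gcongr
    _ = 40 * (Fintype.card ι * ‖l‖) ^ 2 * (1 + ‖m‖ ^ 2) / N := by field_simp; ring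

lemma sum_half_sq_add_sq (hφ : IsLocalized C φ) (m : ι → ZMod N) :
    ∑ y, (φ (y - m) ^ 2 + φ y ^ 2) / 2 = 1 := by
  have hshift : ∑ y, φ (y - m) ^ 2 = ∑ y, φ y ^ 2 :=
    Equiv.sum_comp (Equiv.subRight m) fun y => φ y ^ 2
  rw [← Finset.sum_div, Finset.sum_add_distrib, hshift, hφ.sum_sq, add_self_div_two]

lemma norm_one_sub_weylExpect_le (hφ : IsLocalized C φ) (l m : ι → ℤ) :
    ‖1 - weylExpect (fun j => (φ j : ℂ)) l m‖ ≤
      (C * ‖m‖ ^ 2 / 2 + 40 * (Fintype.card ι * ‖l‖) ^ 2 * (1 + ‖m‖ ^ 2)) / N := by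
  set B : ℝ := 40 * (Fintype.card ι * ‖l‖) ^ 2 * (1 + ‖m‖ ^ 2) / N with hB
  set θ : (ι → ZMod N) → ℝ := fun y => 2 * Real.pi * ((l ⬝ᵥ (2 • minRep y - m) : ℤ) / (2 * N))
  have hone := hφ.sum_half_sq_add_sq (modVec N m)
  rw [hφ.weylExpect_eq_sum_cos, ← Complex.ofReal_one, ← Complex.ofReal_sub, Complex.norm_real,
    Real.norm_eq_abs]
  calc |1 - ∑ y, φ (y - modVec N m) * φ y * Real.cos (θ y)|
      = |∑ y, ((φ (y - modVec N m) ^ 2 + φ y ^ 2) / 2 - φ (y - modVec N m) * φ y *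
          Real.cos (θ y))| := by rw [Finset.sum_sub_distrib, hone]
    _ ≤ ∑ y, ((φ y - φ (y - modVec N m)) ^ 2 / 2 +
          (φ (y - modVec N m) ^ 2 + φ y ^ 2) / 2 * B) :=
        (Finset.abs_sum_le_sum_abs _ _).trans (Finset.sum_le_sum fun y _ =>
          abs_half_sq_add_sq_sub_le (by positivity) (Real.cos_le_one _) (hφ.one_sub_cos_le l m))
    _ = (∑ y, (φ y - φ (y - modVec N m)) ^ 2) / 2 + B := by
        rw [Finset.sum_add_distrib, ← Finset.sum_div, ← Finset.sum_mul, hone, one_mul]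
    _ ≤ C * ‖m‖ ^ 2 / N / 2 + B := by gcongr; exact hφ.sum_sq_sub_shift_le m
    _ = (C * ‖m‖ ^ 2 / 2 + 40 * (Fintype.card ι * ‖l‖) ^ 2 * (1 + ‖m‖ ^ 2)) / N := by
        rw [hB]; ring

end IsLocalized

lemma exists_unit_norm_one_sub_weylExpect_le (ι : Type*) [Fintype ι] [DecidableEq ι] :
    ∃ C : ℝ, 0 ≤ C ∧ ∀ (N : ℕ) [NeZero N], ∃ Φ : (ι → ZMod N) → ℂ, ∑ j, ‖Φ j‖ ^ 2 = 1 ∧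
      ∀ l m : ι → ℤ, ‖1 - weylExpect Φ l m‖ ≤ C * ((1 + ‖l‖) ^ 2 * (1 + ‖m‖) ^ 2) / N := by
  set d := Fintype.card ι
  refine ⟨32 * 4 ^ d / 2 + 40 * (d : ℝ) ^ 2, by positivity, fun N _ => ?_⟩
  obtain ⟨φ, hφ⟩ := exists_isLocalized ι N
  refine ⟨fun j => (φ j : ℂ), ?_, fun l m => (hφ.norm_one_sub_weylExpect_le l m).trans ?_⟩
  · simpa only [Complex.norm_real, Real.norm_eq_abs, sq_abs] using hφ.sum_sq
  have hl : ‖l‖ ^ 2 ≤ (1 + ‖l‖) ^ 2 := by gcongr; linarith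
  have hl₁ : 1 ≤ (1 + ‖l‖) ^ 2 := one_le_pow₀ (by linarith [norm_nonneg l])
  have hm : 1 + ‖m‖ ^ 2 ≤ (1 + ‖m‖) ^ 2 := by nlinarith [norm_nonneg m]
  gcongr
  calc 32 * 4 ^ d * ‖m‖ ^ 2 / 2 + 40 * (d * ‖l‖) ^ 2 * (1 + ‖m‖ ^ 2)
      = 32 * 4 ^ d / 2 * (1 * ‖m‖ ^ 2) + 40 * (d : ℝ) ^ 2 * (‖l‖ ^ 2 * (1 + ‖m‖ ^ 2)) := by ring
    _ ≤ 32 * 4 ^ d / 2 * ((1 + ‖l‖) ^ 2 * (1 + ‖m‖) ^ 2) +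
          40 * (d : ℝ) ^ 2 * ((1 + ‖l‖) ^ 2 * (1 + ‖m‖) ^ 2) := by
        gcongr; linarith
    _ = (32 * 4 ^ d / 2 + 40 * (d : ℝ) ^ 2) * ((1 + ‖l‖) ^ 2 * (1 + ‖m‖) ^ 2) := by ring

/-! ### Coherent states -/

section Coherent

variable {ι : Type*} [Fintype ι] [DecidableEq ι] {N : ℕ} [NeZero N]

lemma sum_pairing_mul_norm_sq (u : (ι → ZMod N) → ℂ) (m : ι → ZMod N) :
    ∑ ξ, pairing m ξ * (‖∑ j, pairing ξ (-j) * u j‖ : ℂ) ^ 2 =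
      N ^ Fintype.card ι * ∑ j, conj (u (j - m)) * u j := by
  have hexpand : ∀ ξ, pairing m ξ * (‖∑ j, pairing ξ (-j) * u j‖ : ℂ) ^ 2 =
      ∑ j, ∑ k, conj (u k) * u j * pairing ξ (k - (j - m)) := fun ξ => by
    rw [← Complex.mul_conj', map_sum, Finset.sum_mul_sum, Finset.mul_sum]
    refine Finset.sum_congr rfl fun j _ => ?_
    rw [Finset.mul_sum]
    refine Finset.sum_congr rfl fun k _ => ?_
    have hphase : k - (j - m) = -j + k + m := by abel
    rw [hphase, pairing_add_right, pairing_add_right, map_mul, conj_pairing, neg_neg,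
      pairing_comm m]
    ring
  simp only [hexpand]
  rw [Finset.sum_comm, Finset.mul_sum]
  refine Finset.sum_congr rfl fun j _ => ?_
  rw [Finset.sum_comm]
  simp only [← Finset.mul_sum, sum_pairing, sub_eq_zero, mul_ite, mul_zero, Finset.sum_ite_eq',
    Finset.mem_univ, if_true]
  ring

/-- The inner product of `v` with the coherent state at `(x, ξ)`, which is the phase space
translation of the profile `Φ` by `(x, ξ)`. -/
def coherent (Φ : (ι → ZMod N) → ℂ) (x ξ : ι → ZMod N) (v : (ι → ZMod N) → ℂ) : ℂ :=
  ∑ j, pairing ξ (-j) * (conj (Φ (j - x)) * v j)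

lemma sum_pairing_mul_norm_coherent_sq (Φ v : (ι → ZMod N) → ℂ) (l m : ι → ZMod N) :
    ∑ x, ∑ ξ, pairing l x * pairing m ξ * (‖coherent Φ x ξ v‖ : ℂ) ^ 2 =
      N ^ Fintype.card ι * (conj (ambiguity Φ l m) * ambiguity v l m) := by
  have hposition : ∀ j, ∑ x, pairing l x * (Φ (j - m - x) * conj (Φ (j - x))) =
      pairing l j * conj (ambiguity Φ l m) := fun j => by
    rw [ambiguity, map_sum, Finset.mul_sum, ← Equiv.sum_comp (Equiv.subLeft j)]
    refine Finset.sum_congr rfl fun y _ => ?_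
    rw [Equiv.subLeft_apply, sub_sub_cancel, sub_right_comm j m, sub_sub_cancel, sub_eq_add_neg j,
      pairing_add_right, map_mul, map_mul, conj_pairing, Complex.conj_conj]
    ring
  calc ∑ x, ∑ ξ, pairing l x * pairing m ξ * (‖coherent Φ x ξ v‖ : ℂ) ^ 2
      = ∑ x, pairing l x * (N ^ Fintype.card ι *
          ∑ j, conj (conj (Φ (j - m - x)) * v (j - m)) * (conj (Φ (j - x)) * v j)) := by
        refine Finset.sum_congr rfl fun x _ => ?_
        rw [← sum_pairing_mul_norm_sq fun j => conj (Φ (j - x)) * v j, Finset.mul_sum]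
        exact Finset.sum_congr rfl fun ξ _ => mul_assoc _ _ _
    _ = N ^ Fintype.card ι * ∑ j, (∑ x, pairing l x * (Φ (j - m - x) * conj (Φ (j - x)))) *
          (conj (v (j - m)) * v j) := by
        simp only [Finset.mul_sum, Finset.sum_mul, map_mul, Complex.conj_conj]
        rw [Finset.sum_comm]
        refine Finset.sum_congr rfl fun j _ => Finset.sum_congr rfl fun x _ => ?_
        ring
    _ = N ^ Fintype.card ι * (conj (ambiguity Φ l m) * ambiguity v l m) := by
        simp only [hposition, ambiguity, Finset.mul_sum]
        refine Finset.sum_congr rfl fun j _ => ?_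
        ring

lemma sum_norm_coherent_sq {Φ : (ι → ZMod N) → ℂ} (hΦ : ∑ j, ‖Φ j‖ ^ 2 = 1)
    (v : (ι → ZMod N) → ℂ) :
    ∑ x, ∑ ξ, ‖coherent Φ x ξ v‖ ^ 2 = N ^ Fintype.card ι * ∑ j, ‖v j‖ ^ 2 := by
  have h := sum_pairing_mul_norm_coherent_sq Φ v 0 0
  simp only [pairing_zero_left, one_mul, ambiguity_zero, hΦ, Complex.ofReal_one, map_one] at h
  exact_mod_cast h

lemma sum_norm_coherent_sq_le_one {Φ : (ι → ZMod N) → ℂ} (hΦ : ∑ j, ‖Φ j‖ ^ 2 = 1)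
    {κ : Type*} {v : κ → EuclideanSpace ℂ (ι → ZMod N)} (hv : Orthonormal ℂ v) (s : Finset κ)
    (x ξ : ι → ZMod N) : ∑ i ∈ s, ‖coherent Φ x ξ (v i)‖ ^ 2 ≤ 1 := by
  let e : EuclideanSpace ℂ (ι → ZMod N) :=
    WithLp.toLp 2 fun j => conj (pairing ξ (-j)) * Φ (j - x)
  have he : ‖e‖ ^ 2 = 1 := by
    rw [EuclideanSpace.norm_sq_eq, ← hΦ, ← Equiv.sum_comp (Equiv.subRight x) fun j => ‖Φ j‖ ^ 2]
    refine Finset.sum_congr rfl fun j _ => ?_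
    rw [norm_mul, RCLike.norm_conj, norm_pairing, one_mul, Equiv.subRight_apply]
  have hinner : ∀ w : EuclideanSpace ℂ (ι → ZMod N), ‖inner ℂ w e‖ = ‖coherent Φ x ξ w‖ := by
    intro w
    rw [norm_inner_symm, PiLp.inner_apply, coherent]
    congr 1
    refine Finset.sum_congr rfl fun j _ => ?_
    rw [RCLike.inner_apply', map_mul, Complex.conj_conj, mul_assoc]
  calc ∑ i ∈ s, ‖coherent Φ x ξ (v i)‖ ^ 2 = ∑ i ∈ s, ‖inner ℂ (v i) e‖ ^ 2 := by
        simp only [hinner]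
    _ ≤ 1 := he ▸ hv.sum_inner_products_le e

/-- The quadratic form at `v` of the anti-Wick quantization of the symbol `b`, with respect to the
coherent states of profile `Φ`. -/
def antiWickForm (Φ : (ι → ZMod N) → ℂ) (b : (ι → ZMod N) → (ι → ZMod N) → ℝ)
    (v : (ι → ZMod N) → ℂ) : ℝ :=
  ((N : ℝ) ^ Fintype.card ι)⁻¹ * ∑ x, ∑ ξ, b x ξ * ‖coherent Φ x ξ v‖ ^ 2

end Coherent

/-! ### Counting orthonormal systems -/

lemma sum_le_two_mul_card_of_sum_mul_le {α : Type*} [Fintype α] {a w : α → ℝ} {M : ℝ} (hM : 0 < M)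
    (ha : ∀ p, 0 ≤ a p) (hw₀ : ∀ p, 0 ≤ w p) (hw₁ : ∀ p, w p ≤ 1)
    (h : ∑ p, a p * w p ≤ M * ∑ p, w p) :
    ∑ p, w p ≤ 2 * Nat.card {p // a p ≤ 2 * M} := by
  classical
  have hpoint : ∀ p, w p ≤ a p * w p / (2 * M) + if a p ≤ 2 * M then 1 else 0 := fun p => by
    split_ifs with hp
    · linarith [hw₁ p, div_nonneg (mul_nonneg (ha p) (hw₀ p)) (by positivity : 0 ≤ 2 * M)]
    · rw [add_zero, le_div_iff₀ (by positivity), mul_comm]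
      exact mul_le_mul_of_nonneg_right (not_le.1 hp).le (hw₀ p)
  have hsum : ∑ p, w p ≤ (∑ p, a p * w p) / (2 * M) + Nat.card {p // a p ≤ 2 * M} := by
    refine (Finset.sum_le_sum fun p _ => hpoint p).trans_eq ?_
    rw [Finset.sum_add_distrib, Finset.sum_div, Finset.sum_boole, Nat.card_eq_fintype_card,
      Fintype.card_subtype]
  have hhalf : (∑ p, a p * w p) / (2 * M) ≤ (∑ p, w p) / 2 := by
    rw [div_le_div_iff₀ (by positivity) two_pos]
    linarith
  linarith

lemma card_mul_card_le_of_antiWickForm_le {ι : Type*} [Fintype ι] [DecidableEq ι] {N : ℕ}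
    [NeZero N] {Φ : (ι → ZMod N) → ℂ} (hΦ : ∑ j, ‖Φ j‖ ^ 2 = 1) {κ : Type*}
    {v : κ → EuclideanSpace ℂ (ι → ZMod N)} (hv : Orthonormal ℂ v) (s : Finset κ)
    {b : (ι → ZMod N) → (ι → ZMod N) → ℝ} (hb : ∀ x ξ, 0 ≤ b x ξ) {M : ℝ} (hM : 0 < M)
    (h : ∀ i ∈ s, antiWickForm Φ b (v i) ≤ M) :
    (N : ℝ) ^ Fintype.card ι * s.card ≤
      2 * Nat.card {p : (ι → ZMod N) × (ι → ZMod N) // b p.1 p.2 ≤ 2 * M} := by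
  have hN : (0 : ℝ) < (N : ℝ) ^ Fintype.card ι := pow_pos (Nat.cast_pos.2 (NeZero.pos N)) _
  set w : (ι → ZMod N) × (ι → ZMod N) → ℝ := fun p => ∑ i ∈ s, ‖coherent Φ p.1 p.2 (v i)‖ ^ 2
  have hmass : ∑ p, w p = N ^ Fintype.card ι * s.card := by
    have hunit : ∀ i, ∑ j, ‖v i j‖ ^ 2 = 1 := fun i => by
      rw [← EuclideanSpace.norm_sq_eq, hv.norm_eq_one, one_pow]
    rw [Finset.sum_comm]
    simp only [Fintype.sum_prod_type, sum_norm_coherent_sq hΦ, hunit, mul_one, Finset.sum_const,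
      nsmul_eq_mul]
    ring
  rw [← hmass]
  refine sum_le_two_mul_card_of_sum_mul_le hM (fun p => hb p.1 p.2)
    (fun p => Finset.sum_nonneg fun i _ => sq_nonneg _)
    (fun p => sum_norm_coherent_sq_le_one hΦ hv s p.1 p.2) ?_
  calc ∑ p, b p.1 p.2 * w p
      = ∑ i ∈ s, N ^ Fintype.card ι * antiWickForm Φ b (v i) := by
        simp only [w, Finset.mul_sum, antiWickForm, mul_inv_cancel_left₀ hN.ne']
        rw [Finset.sum_comm]
        simp only [Fintype.sum_prod_type]
    _ ≤ ∑ _i ∈ s, N ^ Fintype.card ι * M :=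
        Finset.sum_le_sum fun i hi => mul_le_mul_of_nonneg_left (h i hi) hN.le
    _ = M * ∑ p, w p := by rw [hmass, Finset.sum_const, nsmul_eq_mul]; ring

/-! ### Fourier series of smooth functions on the torus -/

section Weight

variable {d : Type*} [Fintype d]

lemma norm_intCast_comp (k : d → ℤ) : ‖(fun i => (k i : ℝ) : d → ℝ)‖ = ‖k‖ := rfl

lemma PeriodicSmooth.exists_pow_mul_norm_mFourierCoeff_le {G : (d → ℝ) → ℂ} (h : PeriodicSmooth G)
    {g : C(UnitAddTorus d, ℂ)} (hg : ∀ w, g (torusPt w) = G w) (M : ℕ) :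
    ∃ B : ℝ, ∀ k, (1 + ‖k‖) ^ M * ‖UnitAddTorus.mFourierCoeff g k‖ ≤ B := by
  classical
  choose B hB using fun i => h.iter i g hg M
  have hB₀ : ∀ i, 0 ≤ B i := fun i => le_trans (by positivity) (hB i 0)
  have hsum : 0 ≤ ∑ i, B i := Finset.sum_nonneg fun i _ => hB₀ i
  refine ⟨‖UnitAddTorus.mFourierCoeff g 0‖ + 2 ^ M * ∑ i, B i, fun k => ?_⟩
  obtain rfl | hk := eq_or_ne k 0
  · rw [norm_zero, add_zero, one_pow, one_mul]
    exact le_add_of_nonneg_right (by positivity)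
  have : Nonempty d := (Function.ne_iff.1 hk).nonempty
  obtain ⟨i, hi⟩ := Finite.exists_max fun i => ‖k i‖
  have hki : ‖k‖ ≤ ‖k i‖ := (pi_norm_le_iff_of_nonempty k).2 hi
  have hki₁ : 1 ≤ ‖k i‖ := by
    rw [Int.norm_eq_abs, ← Int.cast_abs]
    exact_mod_cast Int.one_le_abs (norm_pos_iff.1 ((norm_pos_iff.2 hk).trans_le hki))
  calc (1 + ‖k‖) ^ M * ‖UnitAddTorus.mFourierCoeff g k‖
      ≤ (2 * ‖(k i : ℝ)‖) ^ M * ‖UnitAddTorus.mFourierCoeff g k‖ := by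
        gcongr
        rw [Int.norm_cast_real]
        linarith
    _ = 2 ^ M * (‖(k i : ℝ)‖ ^ M * ‖UnitAddTorus.mFourierCoeff g k‖) := by ring
    _ ≤ 2 ^ M * ∑ i, B i := by
        gcongr
        exact (hB i k).trans (Finset.single_le_sum (fun i _ => hB₀ i) (Finset.mem_univ i))
    _ ≤ ‖UnitAddTorus.mFourierCoeff g 0‖ + 2 ^ M * ∑ i, B i := le_add_of_nonneg_left (norm_nonneg _)

lemma PeriodicSmooth.summable_pow_mul_norm_mFourierCoeff {G : (d → ℝ) → ℂ} (h : PeriodicSmooth G)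
    {g : C(UnitAddTorus d, ℂ)} (hg : ∀ w, g (torusPt w) = G w) (p : ℕ) :
    Summable fun k => (1 + ‖k‖) ^ p * ‖UnitAddTorus.mFourierCoeff g k‖ := by
  obtain ⟨M, -, hs⟩ := summable_int_norm d
  obtain ⟨B, hB⟩ := h.exists_pow_mul_norm_mFourierCoeff_le hg (p + M)
  simp only [norm_intCast_comp] at hs
  refine Summable.of_norm_bounded_eventually (hs.mul_left B)
    ((Filter.eventually_cofinite_ne 0).mono fun k hk => ?_)
  rw [Real.norm_of_nonneg (by positivity), inv_pow, ← div_eq_mul_inv, le_div_iff₀ (by positivity)]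
  calc (1 + ‖k‖) ^ p * ‖UnitAddTorus.mFourierCoeff g k‖ * ‖k‖ ^ M
      ≤ (1 + ‖k‖) ^ p * ‖UnitAddTorus.mFourierCoeff g k‖ * (1 + ‖k‖) ^ M := by
        gcongr
        linarith
    _ = (1 + ‖k‖) ^ (p + M) * ‖UnitAddTorus.mFourierCoeff g k‖ := by ring
    _ ≤ B := hB k

end Weight

section Expansion

open scoped RealInnerProductSpace

variable {n : ℕ} {f : EuclideanSpace ℝ (Fin n) × EuclideanSpace ℝ (Fin n) → ℂ}
  {c : (Fin n ⊕ Fin n → ℤ) → ℂ}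

/-- `f` is the pointwise sum of the Fourier series with coefficients `c`, whose frequencies are
split into a position and a momentum part. -/
def IsFourierSum (f : EuclideanSpace ℝ (Fin n) × EuclideanSpace ℝ (Fin n) → ℂ)
    (c : (Fin n ⊕ Fin n → ℤ) → ℂ) : Prop :=
  ∀ x ξ, HasSum (fun q => c q * exp2pi (⟪intVec (q ∘ Sum.inl), x⟫ + ⟪intVec (q ∘ Sum.inr), ξ⟫))
    (f (x, ξ))

lemma IsSmoothOnTorus.periodicSmooth (hf : IsSmoothOnTorus f) :
    PeriodicSmooth fun w : Fin n ⊕ Fin n → ℝ =>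
      f (WithLp.toLp 2 (w ∘ Sum.inl), WithLp.toLp 2 (w ∘ Sum.inr)) where
  contDiff := hf.contDiff.comp <|
    (PiLp.contDiff_toLp.comp (contDiff_pi.2 fun _ => contDiff_apply ℝ ℝ _)).prodMk
      (PiLp.contDiff_toLp.comp (contDiff_pi.2 fun _ => contDiff_apply ℝ ℝ _))
  periodic k w := hf.periodic (k ∘ Sum.inl) (k ∘ Sum.inr) (WithLp.toLp 2 (w ∘ Sum.inl))
    (WithLp.toLp 2 (w ∘ Sum.inr))

lemma IsSmoothOnTorus.exists_isFourierSum (hf : IsSmoothOnTorus f) (p : ℕ) :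
    ∃ c, Summable (fun q => (1 + ‖q‖) ^ p * ‖c q‖) ∧ IsFourierSum f c := by
  have hG := hf.periodicSmooth
  obtain ⟨g, hg⟩ := hG.desc
  refine ⟨UnitAddTorus.mFourierCoeff g, hG.summable_pow_mul_norm_mFourierCoeff hg p, fun x ξ => ?_⟩
  convert UnitAddTorus.hasSum_mFourier_series_apply_of_summable (hG.summable g hg)
    (torusPt (Sum.elim x ξ)) using 1
  · funext q
    rw [mFourier_torusPt, exp2pi, inner_intVec, inner_intVec, Fintype.sum_sum_type, smul_eq_mul]
    congr 2
    push_cast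
    simp only [Sum.elim_inl, Sum.elim_inr, Function.comp_apply]
    ring
  · rw [hg]
    rfl

variable {N : ℕ} [NeZero N]

/-- The point `x/N` of the unit cube. -/
def residuePt (x : Fin n → ZMod N) : EuclideanSpace ℝ (Fin n) := gridPt N fun i => (x i).val

lemma modVec_val {ι : Type*} (x : ι → ZMod N) : modVec N (fun i => ((x i).val : ℤ)) = x :=
  funext fun i => by rw [modVec, Int.cast_natCast, ZMod.natCast_zmod_val]

lemma exp2pi_inner_residuePt (l : Fin n → ℤ) (x : Fin n → ZMod N) :
    exp2pi ⟪intVec l, residuePt x⟫ = pairing (modVec N l) x := by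
  nth_rewrite 2 [← modVec_val x]
  rw [pairing_modVec, inner_intVec, dotProduct]
  push_cast
  simp only [Finset.sum_div, residuePt, gridPt, mul_div_assoc, Int.cast_natCast]

lemma weylPhase_eq_pairing (j : Fin n → ZMod N) (l m : Fin n → ℤ) :
    weylPhase N j l m = pairing (modVec N l) j * exp2pi (-((l ⬝ᵥ m : ℤ) / (2 * N))) := by
  nth_rewrite 2 [← modVec_val j]
  rw [weylPhase, sub_eq_add_neg, exp2pi_add, pairing_modVec, dotProduct, dotProduct]
  push_cast
  rfl

lemma IsFourierSum.hasSum_residuePt (hf : IsFourierSum f c) (x ξ : Fin n → ZMod N) :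
    HasSum (fun q => c q *
        (pairing (modVec N (q ∘ Sum.inl)) x * pairing (modVec N (q ∘ Sum.inr)) ξ))
      (f (residuePt x, residuePt ξ)) := by
  simpa only [exp2pi_add, exp2pi_inner_residuePt] using hf (residuePt x) (residuePt ξ)

end Expansion

/-! ### Comparison of `f_N f_N^*` with the anti-Wick quantization of `|f|²` -/

lemma pairing_sub_left {ι : Type*} [Fintype ι] {N : ℕ} [NeZero N] (x y z : ι → ZMod N) :
    pairing (x - y) z = pairing x z * pairing y (-z) := by
  rw [pairing, sub_dotProduct, sub_eq_add_neg, AddChar.map_add_eq_mul, ← dotProduct_neg, pairing,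
    pairing]

lemma hasSum_mul_conj_self {κ : Type*} {A : κ → ℂ} {a : ℂ} (hA : Summable fun q => ‖A q‖)
    (ha : HasSum A a) : HasSum (fun p : κ × κ => A p.1 * conj (A p.2)) ((‖a‖ : ℂ) ^ 2) := by
  have hsummable :=
    summable_mul_of_summable_norm hA ((summable_congr fun q => norm_star (A q)).2 hA)
  have hprod := ha.mul ha.star hsummable
  rw [← Complex.mul_conj']
  exact hprod

section WeylTranslation

variable {ι : Type*} [Fintype ι] {N : ℕ} [NeZero N]

/-- The adjoint of the Weyl translation with frequencies `(l, m)`, which is the quantization of the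
exponential `exp(2πi(⟨l, x⟩ + ⟨m, ξ⟩))`. -/
def weylAdjoint (l m : ι → ℤ) (v : (ι → ZMod N) → ℂ) (j : ι → ZMod N) : ℂ :=
  exp2pi ((l ⬝ᵥ m : ℤ) / (2 * N)) * pairing (modVec N l) (-j) * v (j - modVec N m)

lemma norm_weylAdjoint (l m : ι → ℤ) (v : (ι → ZMod N) → ℂ) (j : ι → ZMod N) :
    ‖weylAdjoint l m v j‖ = ‖v (j - modVec N m)‖ := by
  rw [weylAdjoint, norm_mul, norm_mul, norm_exp2pi, norm_pairing, one_mul, one_mul]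

/-- The standard symplectic form on frequencies, split into a position and a momentum part. -/
def symplecticForm (q r : ι ⊕ ι → ℤ) : ℤ :=
  (q ∘ Sum.inl) ⬝ᵥ (r ∘ Sum.inr) - (r ∘ Sum.inl) ⬝ᵥ (q ∘ Sum.inr)

variable [DecidableEq ι]

lemma sum_conj_weylAdjoint_mul (l m l' m' : ι → ℤ) (v : (ι → ZMod N) → ℂ) :
    ∑ j, conj (weylAdjoint l m v j) * weylAdjoint l' m' v j =
      exp2pi ((l ⬝ᵥ m' - l' ⬝ᵥ m : ℤ) / (2 * N)) * weylExpect v (l - l') (m - m') := by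
  have hphase : exp2pi (-((l ⬝ᵥ m : ℤ) / (2 * N))) * exp2pi ((l' ⬝ᵥ m' : ℤ) / (2 * N)) *
      pairing (modVec N (l - l')) (modVec N m') =
      exp2pi ((l ⬝ᵥ m' - l' ⬝ᵥ m : ℤ) / (2 * N)) *
        exp2pi (-(((l - l') ⬝ᵥ (m - m') : ℤ) / (2 * N))) := by
    rw [pairing_modVec, ← exp2pi_add, ← exp2pi_add, ← exp2pi_add]
    congr 1
    simp only [sub_dotProduct, dotProduct_sub]
    push_cast
    field_simp
    ring
  rw [weylExpect, ambiguity, ← mul_assoc, ← hphase, Finset.mul_sum,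
    ← Equiv.sum_comp (Equiv.addRight (modVec N m'))]
  refine Finset.sum_congr rfl fun j _ => ?_
  have hshift : j + modVec N m' - modVec N m = j - modVec N (m - m') := by rw [modVec_sub]; abel
  have hpair : pairing (modVec N (l - l')) (modVec N m') * pairing (modVec N (l - l')) j =
      pairing (modVec N l) (j + modVec N m') * pairing (modVec N l') (-(j + modVec N m')) := by
    rw [← pairing_add_right, modVec_sub, pairing_sub_left, add_comm j]
  rw [Equiv.coe_addRight, weylAdjoint, weylAdjoint, hshift, add_sub_cancel_right, map_mul, map_mul,
    conj_exp2pi, conj_pairing, neg_neg]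
  linear_combination -(exp2pi (-((l ⬝ᵥ m : ℤ) / (2 * N))) * exp2pi ((l' ⬝ᵥ m' : ℤ) / (2 * N)) *
    (conj (v (j - modVec N (m - m'))) * v j)) * hpair

lemma conj_weylExpect_mul_weylExpect (Φ v : (ι → ZMod N) → ℂ) (l m : ι → ℤ) :
    conj (weylExpect Φ l m) * weylExpect v l m =
      conj (ambiguity Φ (modVec N l) (modVec N m)) * ambiguity v (modVec N l) (modVec N m) := by
  have hphase : exp2pi ((l ⬝ᵥ m : ℤ) / (2 * N)) * exp2pi (-((l ⬝ᵥ m : ℤ) / (2 * N))) = 1 := by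
    rw [← exp2pi_add, add_neg_cancel, exp2pi, mul_zero, Complex.ofReal_zero, zero_mul,
      Complex.exp_zero]
  rw [weylExpect, weylExpect, map_mul, conj_exp2pi, neg_neg, mul_mul_mul_comm, hphase, one_mul]

end WeylTranslation

section Series

open Matrix

variable {n : ℕ} {f : EuclideanSpace ℝ (Fin n) × EuclideanSpace ℝ (Fin n) → ℂ}
  {c : (Fin n ⊕ Fin n → ℤ) → ℂ} {N : ℕ} [NeZero N]

lemma IsFourierSum.hasSum_quantize (hf : IsFourierSum f c) (hc : Summable fun q => ‖c q‖)
    (p j : Fin n → ZMod N) :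
    HasSum (fun q => if p = j - modVec N (q ∘ Sum.inr) then
      c q * weylPhase N j (q ∘ Sum.inl) (q ∘ Sum.inr) else 0) (quantize f N p j) := by
  have hentry : quantize f N p j = ∑' q, if p = j - modVec N (q ∘ Sum.inr) then
      c q * weylPhase N j (q ∘ Sum.inl) (q ∘ Sum.inr) else 0 := by
    rw [quantize_eq_of_hasSum N f c hc hf]
    exact tsum_congr fun q => by simp only [funext_iff]; rfl
  rw [hentry]
  refine (Summable.of_norm_bounded hc fun q => ?_).hasSum
  split_ifs
  · rw [norm_mul, weylPhase, norm_exp2pi, mul_one]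
  · exact norm_zero.trans_le (norm_nonneg _)

lemma IsFourierSum.hasSum_conj_conjTranspose_mulVec (hf : IsFourierSum f c)
    (hc : Summable fun q => ‖c q‖) (v : (Fin n → ZMod N) → ℂ) (j : Fin n → ZMod N) :
    HasSum (fun q => c q * conj (weylAdjoint (q ∘ Sum.inl) (q ∘ Sum.inr) v j))
      (conj (((quantize f N)ᴴ *ᵥ v) j)) := by
  have hrow := hasSum_sum fun p (_ : p ∈ Finset.univ) =>
    (hf.hasSum_quantize hc p j).mul_right (conj (v p))
  have hvalue : conj (((quantize f N)ᴴ *ᵥ v) j) = ∑ p, quantize f N p j * conj (v p) := by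
    simp only [mulVec, dotProduct, conjTranspose_apply, map_sum, map_mul, RCLike.star_def,
      Complex.conj_conj]
  rw [hvalue]
  refine hrow.congr_fun fun q => ?_
  simp only [ite_mul, zero_mul, Finset.sum_ite_eq', Finset.mem_univ, if_true]
  rw [weylPhase_eq_pairing, weylAdjoint, map_mul, map_mul, conj_exp2pi, conj_pairing, neg_neg]
  ring

lemma IsFourierSum.hasSum_norm_conjTranspose_mulVec_sq (hf : IsFourierSum f c)
    (hc : Summable fun q => ‖c q‖) (v : (Fin n → ZMod N) → ℂ) :
    HasSum (fun p : (Fin n ⊕ Fin n → ℤ) × (Fin n ⊕ Fin n → ℤ) => c p.1 * conj (c p.2) *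
      (exp2pi (symplecticForm p.1 p.2 / (2 * N)) *
        weylExpect v ((p.1 - p.2) ∘ Sum.inl) ((p.1 - p.2) ∘ Sum.inr)))
      ((∑ j, ‖((quantize f N)ᴴ *ᵥ v) j‖ ^ 2 : ℝ) : ℂ) := by
  have hsummable : ∀ j, Summable fun q =>
      ‖c q * conj (weylAdjoint (q ∘ Sum.inl) (q ∘ Sum.inr) v j)‖ := fun j => by
    refine Summable.of_nonneg_of_le (fun _ => norm_nonneg _) (fun q => ?_) (hc.mul_right ‖v‖)
    rw [norm_mul, RCLike.norm_conj, norm_weylAdjoint]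
    gcongr
    exact norm_le_pi_norm v _
  have hsum := hasSum_sum fun j (_ : j ∈ Finset.univ) =>
    hasSum_mul_conj_self (hsummable j) (hf.hasSum_conj_conjTranspose_mulVec hc v j)
  simp only [RCLike.norm_conj] at hsum
  simp only [Complex.ofReal_sum, Complex.ofReal_pow]
  refine hsum.congr_fun fun p => ?_
  have hlaw := sum_conj_weylAdjoint_mul (p.1 ∘ Sum.inl) (p.1 ∘ Sum.inr) (p.2 ∘ Sum.inl)
    (p.2 ∘ Sum.inr) v
  rw [symplecticForm, Pi.sub_comp, Pi.sub_comp, ← hlaw, Finset.mul_sum]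
  refine Finset.sum_congr rfl fun j _ => ?_
  rw [map_mul, Complex.conj_conj]
  ring

lemma IsFourierSum.hasSum_antiWickForm (hf : IsFourierSum f c) (hc : Summable fun q => ‖c q‖)
    (Φ v : (Fin n → ZMod N) → ℂ) :
    HasSum (fun p : (Fin n ⊕ Fin n → ℤ) × (Fin n ⊕ Fin n → ℤ) => c p.1 * conj (c p.2) *
      (conj (weylExpect Φ ((p.1 - p.2) ∘ Sum.inl) ((p.1 - p.2) ∘ Sum.inr)) *
        weylExpect v ((p.1 - p.2) ∘ Sum.inl) ((p.1 - p.2) ∘ Sum.inr)))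
      (antiWickForm Φ (fun x ξ => ‖f (residuePt x, residuePt ξ)‖ ^ 2) v : ℂ) := by
  have hN : (N : ℂ) ^ Fintype.card (Fin n) ≠ 0 := pow_ne_zero _ (NeZero.ne _)
  have hsummable : ∀ x ξ : Fin n → ZMod N, Summable fun q =>
      ‖c q * (pairing (modVec N (q ∘ Sum.inl)) x * pairing (modVec N (q ∘ Sum.inr)) ξ)‖ :=
    fun x ξ => by simpa only [norm_mul, norm_pairing, mul_one] using hc
  have hsum := (hasSum_sum fun x (_ : x ∈ Finset.univ) => hasSum_sum fun ξ (_ : ξ ∈ Finset.univ) =>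
    (hasSum_mul_conj_self (hsummable x ξ) (hf.hasSum_residuePt x ξ)).mul_right
      ((‖coherent Φ x ξ v‖ : ℂ) ^ 2)).mul_left ((N : ℂ) ^ Fintype.card (Fin n))⁻¹
  rw [antiWickForm]
  push_cast
  refine hsum.congr_fun fun p => ?_
  rw [conj_weylExpect_mul_weylExpect, ← mul_right_inj' hN, mul_inv_cancel_left₀ hN,
    mul_left_comm, ← sum_pairing_mul_norm_coherent_sq, Finset.mul_sum]
  refine Finset.sum_congr rfl fun x _ => ?_
  rw [Finset.mul_sum]
  refine Finset.sum_congr rfl fun ξ _ => ?_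
  rw [Pi.sub_comp, Pi.sub_comp, modVec_sub, modVec_sub, pairing_sub_left, pairing_sub_left]
  simp only [map_mul, conj_pairing]
  ring

end Series

section Comparison

open Matrix

lemma abs_symplecticForm_le {ι : Type*} [Fintype ι] (q r : ι ⊕ ι → ℤ) :
    |(symplecticForm q r : ℝ)| ≤ 2 * Fintype.card ι * (‖q‖ * ‖r‖) := by
  have hqr : |((q ∘ Sum.inl ⬝ᵥ r ∘ Sum.inr : ℤ) : ℝ)| ≤ Fintype.card ι * (‖q‖ * ‖r‖) :=
    (abs_dotProduct_le _ _).trans (by gcongr <;> exact pi_norm_comp_le _ _)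
  have hrq : |((r ∘ Sum.inl ⬝ᵥ q ∘ Sum.inr : ℤ) : ℝ)| ≤ Fintype.card ι * (‖r‖ * ‖q‖) :=
    (abs_dotProduct_le _ _).trans (by gcongr <;> exact pi_norm_comp_le _ _)
  rw [symplecticForm, Int.cast_sub]
  linarith [abs_sub ((q ∘ Sum.inl ⬝ᵥ r ∘ Sum.inr : ℤ) : ℝ) ((r ∘ Sum.inl ⬝ᵥ q ∘ Sum.inr : ℤ) : ℝ)]

lemma one_add_norm_sub_le {E : Type*} [SeminormedAddCommGroup E] (x y : E) :
    1 + ‖x - y‖ ≤ (1 + ‖x‖) * (1 + ‖y‖) := by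
  linarith [norm_sub_le x y, mul_nonneg (norm_nonneg x) (norm_nonneg y)]

variable {N : ℕ} [NeZero N]

lemma norm_exp2pi_symplecticForm_sub_conj_weylExpect_le {ι : Type*} [Fintype ι] [DecidableEq ι]
    {Φ : (ι → ZMod N) → ℂ} {C : ℝ} (hC : 0 ≤ C)
    (hΦ : ∀ l m, ‖1 - weylExpect Φ l m‖ ≤ C * ((1 + ‖l‖) ^ 2 * (1 + ‖m‖) ^ 2) / N)
    (q r : ι ⊕ ι → ℤ) :
    ‖exp2pi (symplecticForm q r / (2 * N)) -
        conj (weylExpect Φ ((q - r) ∘ Sum.inl) ((q - r) ∘ Sum.inr))‖ ≤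
      (2 * Real.pi * Fintype.card ι + C) / N * ((1 + ‖q‖) ^ 4 * (1 + ‖r‖) ^ 4) := by
  have hN : (0 : ℝ) < N := Nat.cast_pos.2 (NeZero.pos N)
  set γ := weylExpect Φ ((q - r) ∘ Sum.inl) ((q - r) ∘ Sum.inr)
  have hphase : ‖exp2pi (symplecticForm q r / (2 * N)) - 1‖ ≤
      2 * Real.pi * Fintype.card ι / N * ((1 + ‖q‖) ^ 4 * (1 + ‖r‖) ^ 4) := calc
    ‖exp2pi (symplecticForm q r / (2 * N)) - 1‖
        ≤ 2 * Real.pi * |(symplecticForm q r : ℝ) / (2 * N)| := norm_exp2pi_sub_one_le _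
    _ ≤ 2 * Real.pi * (2 * Fintype.card ι * (‖q‖ * ‖r‖) / (2 * N)) := by
        rw [abs_div, abs_of_pos (by positivity : (0 : ℝ) < 2 * N)]
        gcongr
        exact abs_symplecticForm_le q r
    _ = 2 * Real.pi * Fintype.card ι / N * (‖q‖ * ‖r‖) := by field_simp
    _ ≤ _ := by
        have hpow (x : ι ⊕ ι → ℤ) : ‖x‖ ≤ (1 + ‖x‖) ^ 4 :=
          (le_add_of_nonneg_left zero_le_one).trans
            (le_self_pow₀ (le_add_of_nonneg_right (norm_nonneg x)) four_ne_zero)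
        gcongr <;> exact hpow _
  have hexpect : ‖1 - conj γ‖ ≤ C / N * ((1 + ‖q‖) ^ 4 * (1 + ‖r‖) ^ 4) := calc
    ‖1 - conj γ‖ = ‖1 - γ‖ := by rw [← RCLike.norm_conj, map_sub, map_one, Complex.conj_conj]
    _ ≤ C * ((1 + ‖q - r‖) ^ 2 * (1 + ‖q - r‖) ^ 2) / N :=
        (hΦ _ _).trans (by gcongr <;> exact pi_norm_comp_le _ _)
    _ = C / N * (1 + ‖q - r‖) ^ 4 := by ring
    _ ≤ C / N * ((1 + ‖q‖) * (1 + ‖r‖)) ^ 4 := by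
        gcongr
        exact one_add_norm_sub_le q r
    _ = C / N * ((1 + ‖q‖) ^ 4 * (1 + ‖r‖) ^ 4) := by rw [mul_pow]
  rw [← sub_add_sub_cancel _ 1, add_div, add_mul]
  exact norm_add_le_of_le hphase hexpect

variable {n : ℕ} {f : EuclideanSpace ℝ (Fin n) × EuclideanSpace ℝ (Fin n) → ℂ}

lemma IsFourierSum.abs_sub_antiWickForm_le {c : (Fin n ⊕ Fin n → ℤ) → ℂ} (hf : IsFourierSum f c)
    (hc : Summable fun q => (1 + ‖q‖) ^ 4 * ‖c q‖) {Φ : (Fin n → ZMod N) → ℂ} {C : ℝ} (hC : 0 ≤ C)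
    (hΦ : ∀ l m, ‖1 - weylExpect Φ l m‖ ≤ C * ((1 + ‖l‖) ^ 2 * (1 + ‖m‖) ^ 2) / N)
    (v : (Fin n → ZMod N) → ℂ) :
    |∑ j, ‖((quantize f N)ᴴ *ᵥ v) j‖ ^ 2 -
        antiWickForm Φ (fun x ξ => ‖f (residuePt x, residuePt ξ)‖ ^ 2) v| ≤
      (2 * Real.pi * n + C) * (∑' q, (1 + ‖q‖) ^ 4 * ‖c q‖) ^ 2 / N * ∑ j, ‖v j‖ ^ 2 := by
  have hc₀ : Summable fun q => ‖c q‖ := hc.of_nonneg_of_le (fun _ => norm_nonneg _) fun q =>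
    le_mul_of_one_le_left (norm_nonneg _) (one_le_pow₀ (le_add_of_nonneg_right (norm_nonneg q)))
  have hdiff := (hf.hasSum_norm_conjTranspose_mulVec_sq hc₀ v).sub (hf.hasSum_antiWickForm hc₀ Φ v)
  have hweights := (hc.hasSum.mul hc.hasSum (hc.mul_of_nonneg hc (fun _ => by positivity)
    fun _ => by positivity)).mul_left ((2 * Real.pi * n + C) / N * ∑ j, ‖v j‖ ^ 2)
  rw [← Complex.ofReal_sub] at hdiff
  rw [← Real.norm_eq_abs, ← Complex.norm_real, ← hdiff.tsum_eq]
  refine (tsum_of_norm_bounded hweights fun p => ?_).trans_eq (by ring)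
  have herror := norm_exp2pi_symplecticForm_sub_conj_weylExpect_le hC hΦ p.1 p.2
  rw [Fintype.card_fin] at herror
  rw [← mul_sub, ← sub_mul, norm_mul, norm_mul, norm_mul, RCLike.norm_conj]
  calc _ ≤ ‖c p.1‖ * ‖c p.2‖ * ((2 * Real.pi * n + C) / N * ((1 + ‖p.1‖) ^ 4 * (1 + ‖p.2‖) ^ 4) *
        ∑ j, ‖v j‖ ^ 2) := by
        gcongr
        exact norm_weylExpect_le _ _ _
    _ = _ := by ring

lemma IsSmoothOnTorus.exists_abs_sub_antiWickForm_le (hf : IsSmoothOnTorus f) :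
    ∃ D : ℝ, 0 ≤ D ∧ ∀ (N : ℕ) [NeZero N], ∃ Φ : (Fin n → ZMod N) → ℂ, ∑ j, ‖Φ j‖ ^ 2 = 1 ∧
      ∀ v, |∑ j, ‖((quantize f N)ᴴ *ᵥ v) j‖ ^ 2 -
          antiWickForm Φ (fun x ξ => ‖f (residuePt x, residuePt ξ)‖ ^ 2) v| ≤
        D / N * ∑ j, ‖v j‖ ^ 2 := by
  obtain ⟨c, hc, hsum⟩ := hf.exists_isFourierSum 4
  obtain ⟨C, hC, hstate⟩ := exists_unit_norm_one_sub_weylExpect_le (Fin n)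
  refine ⟨(2 * Real.pi * n + C) * (∑' q, (1 + ‖q‖) ^ 4 * ‖c q‖) ^ 2, by positivity, fun N _ => ?_⟩
  obtain ⟨Φ, hunit, hΦ⟩ := hstate N
  exact ⟨Φ, hunit, hsum.abs_sub_antiWickForm_le hc hC hΦ⟩

end Comparison

/-! ### From rank to the number of grid points where `f` is small -/

section Rank

open Matrix

variable {ι : Type*} [Fintype ι] [DecidableEq ι]

lemma matrixFun_eq_conjStarAlgAut {A : Matrix ι ι ℂ} (hA : A.IsHermitian) (ψ : ℝ → ℂ) :
    matrixFun ψ A = Unitary.conjStarAlgAut ℂ _ hA.eigenvectorUnitary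
      (diagonal fun i => ψ (hA.eigenvalues i)) := by
  rw [matrixFun, hA.cfc_eq, hA.cfc_eq, IsHermitian.cfc, IsHermitian.cfc, ← map_smul, ← map_add,
    ← diagonal_smul, diagonal_add]
  congr 2
  funext i
  simp only [Pi.smul_apply, Function.comp_apply, smul_eq_mul]
  rw [mul_comm]
  exact Complex.re_add_im _

lemma rank_matrixFun_le {A : Matrix ι ι ℂ} (hA : A.IsHermitian) (ψ : ℝ → ℂ) :
    (matrixFun ψ A).rank ≤ Fintype.card {i // ψ (hA.eigenvalues i) ≠ 0} := by
  rw [matrixFun_eq_conjStarAlgAut hA, Unitary.conjStarAlgAut_apply, ← rank_diagonal]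
  exact (rank_mul_le_left _ _).trans (rank_mul_le_right _ _)

lemma eigenvalues_smul_mul_conjTranspose {F : Matrix ι ι ℂ} {s : ℝ}
    (hA : (s • (F * Fᴴ)).IsHermitian) (i : ι) :
    hA.eigenvalues i = s * ∑ j, ‖(Fᴴ *ᵥ hA.eigenvectorBasis i) j‖ ^ 2 := by
  have hstar (u : ι → ℂ) : star u ⬝ᵥ (F * Fᴴ) *ᵥ u = ((∑ j, ‖(Fᴴ *ᵥ u) j‖ ^ 2 : ℝ) : ℂ) := by
    rw [← mulVec_mulVec, dotProduct_mulVec, ← conjTranspose_conjTranspose F, ← star_mulVec,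
      conjTranspose_conjTranspose]
    simp only [dotProduct, Pi.star_apply, Complex.star_def, Complex.conj_mul', Complex.ofReal_sum,
      Complex.ofReal_pow]
  rw [hA.eigenvalues_eq, smul_mulVec, dotProduct_smul, hstar, RCLike.smul_re]
  rfl

end Rank

open Matrix in
theorem IsSmoothOnTorus.exists_pow_mul_rank_matrixFun_le {n : ℕ}
    {f : EuclideanSpace ℝ (Fin n) × EuclideanSpace ℝ (Fin n) → ℂ} (hf : IsSmoothOnTorus f) :
    ∃ D : ℝ, 0 ≤ D ∧ ∀ (N : ℕ) [NeZero N] (a R : ℝ) (ψ : ℝ → ℂ), 0 < a → 0 < R →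
      (∀ t, ψ t ≠ 0 → t ≤ R) →
      (N : ℝ) ^ n * (matrixFun ψ (a⁻¹ • (quantize f N * (quantize f N)ᴴ))).rank ≤
        2 * Nat.card {p : (Fin n → ZMod N) × (Fin n → ZMod N) //
          ‖f (residuePt p.1, residuePt p.2)‖ ^ 2 ≤ 2 * (R * a + D / N)} := by
  obtain ⟨D, hD, hcompare⟩ := hf.exists_abs_sub_antiWickForm_le
  refine ⟨D, hD, fun N _ a R ψ ha hR hψ => ?_⟩
  obtain ⟨Φ, hΦ, hform⟩ := hcompare N
  have hA : (a⁻¹ • (quantize f N * (quantize f N)ᴴ)).IsHermitian :=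
    (isHermitian_mul_conjTranspose_self _).smul (IsSelfAdjoint.all _)
  have hsmall : ∀ i, ψ (hA.eigenvalues i) ≠ 0 → antiWickForm Φ
      (fun x ξ => ‖f (residuePt x, residuePt ξ)‖ ^ 2) (hA.eigenvectorBasis i) ≤ R * a + D / N := by
    intro i hi
    have heigen := hψ _ hi
    have hdiff := hform (hA.eigenvectorBasis i)
    rw [eigenvalues_smul_mul_conjTranspose, inv_mul_le_iff₀ ha, mul_comm] at heigen
    rw [← EuclideanSpace.norm_sq_eq, hA.eigenvectorBasis.orthonormal.norm_eq_one, one_pow,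
      mul_one] at hdiff
    linarith [(abs_le.1 hdiff).1]
  classical
  have hcount := card_mul_card_le_of_antiWickForm_le hΦ hA.eigenvectorBasis.orthonormal
    {i | ψ (hA.eigenvalues i) ≠ 0} (fun _ _ => sq_nonneg _) (by positivity)
    fun i hi => hsmall i (Finset.mem_filter.1 hi).2
  have hrank := rank_matrixFun_le hA ψ
  rw [Fintype.card_subtype] at hrank
  rw [Fintype.card_fin] at hcount
  exact (mul_le_mul_of_nonneg_left (Nat.cast_le.2 hrank) (by positivity)).trans hcount

/-! ### Grid points and volume -/

section Volume

open MeasureTheory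

lemma norm_le_card_mul_of_forall_norm_le {ι : Type*} [Fintype ι] {w : EuclideanSpace ℝ ι} {r : ℝ}
    (h : ∀ i, ‖w i‖ ≤ r) : ‖w‖ ≤ Fintype.card ι * r := by
  have hsum : ‖w‖ ≤ ∑ i, ‖w i‖ := by
    rw [EuclideanSpace.norm_eq]
    exact Real.sqrt_le_iff.2 ⟨Finset.sum_nonneg fun _ _ => norm_nonneg _,
      Finset.sum_sq_le_sq_sum_of_nonneg fun _ _ => norm_nonneg _⟩
  refine hsum.trans ((Finset.sum_le_card_nsmul _ _ _ fun i _ => h i).trans_eq ?_)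
  rw [Finset.card_univ, nsmul_eq_mul]

variable {n : ℕ}

lemma isBounded_fundamentalCube (n : ℕ) : Bornology.IsBounded (fundamentalCube n) := by
  refine isBounded_iff_forall_norm_le.2 ⟨Fintype.card (Fin n) * 1, fun w hw => ?_⟩
  have hcoord : ∀ t : ℝ, t ∈ Set.Ico (0 : ℝ) 1 → ‖t‖ ≤ 1 := fun t ht => by
    rw [Real.norm_of_nonneg ht.1]
    exact ht.2.le
  exact norm_prod_le_iff.2 ⟨norm_le_card_mul_of_forall_norm_le fun i => hcoord _ (hw i).1,
    norm_le_card_mul_of_forall_norm_le fun i => hcoord _ (hw i).2⟩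

section Cell

variable {N : ℕ}

/-- The cube of side `1/N` whose lower corner is the grid point `x/N`. -/
def cell (x : Fin n → ZMod N) : Set (EuclideanSpace ℝ (Fin n)) :=
  {w | ∀ i, ⌊N * w i⌋ = (x i).val}

lemma cell_eq_preimage (x : Fin n → ZMod N) :
    cell x = (WithLp.ofLp : EuclideanSpace ℝ (Fin n) → Fin n → ℝ) ⁻¹'
      Set.univ.pi fun i => ((N : ℝ) * ·) ⁻¹' Set.Ico ((x i).val : ℝ) ((x i).val + 1) := by
  ext w
  simp only [cell, Int.floor_eq_iff, Int.cast_natCast, Set.mem_ofPred_eq, Set.mem_preimage,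
    Set.mem_univ_pi, Set.mem_Ico]

lemma measurableSet_univ_pi_preimage_mul_Ico (x : Fin n → ZMod N) : MeasurableSet
    (Set.univ.pi fun i => ((N : ℝ) * ·) ⁻¹' Set.Ico ((x i).val : ℝ) ((x i).val + 1)) :=
  MeasurableSet.univ_pi fun _ => measurable_const_mul _ measurableSet_Ico

lemma measurableSet_cell (x : Fin n → ZMod N) : MeasurableSet (cell x) := by
  rw [cell_eq_preimage]
  exact (PiLp.volume_preserving_ofLp (Fin n)).measurable (measurableSet_univ_pi_preimage_mul_Ico x)

variable [NeZero N]

lemma volume_cell (x : Fin n → ZMod N) : volume (cell x) = ENNReal.ofReal ((N : ℝ) ^ n)⁻¹ := by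
  have hN : (N : ℝ) ≠ 0 := NeZero.ne _
  rw [cell_eq_preimage, (PiLp.volume_preserving_ofLp (Fin n)).measure_preimage
    (measurableSet_univ_pi_preimage_mul_Ico x).nullMeasurableSet, volume_pi_pi]
  simp only [Real.volume_preimage_mul_left hN, Real.volume_Ico, add_sub_cancel_left,
    ENNReal.ofReal_one, mul_one, Finset.prod_const, Finset.card_univ, Fintype.card_fin]
  rw [← ENNReal.ofReal_pow (abs_nonneg _), abs_inv, Nat.abs_cast, inv_pow]

lemma eq_of_mem_cell {x y : Fin n → ZMod N} {w : EuclideanSpace ℝ (Fin n)} (hx : w ∈ cell x)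
    (hy : w ∈ cell y) : x = y :=
  funext fun i => ZMod.val_injective N (Nat.cast_injective ((hx i).symm.trans (hy i)))

lemma mem_Ico_of_mem_cell {x : Fin n → ZMod N} {w : EuclideanSpace ℝ (Fin n)} (hw : w ∈ cell x)
    (i : Fin n) : w i ∈ Set.Ico (0 : ℝ) 1 := by
  have hN : (0 : ℝ) < N := Nat.cast_pos.2 (NeZero.pos N)
  obtain ⟨hlower, hupper⟩ := Int.floor_eq_iff.1 (hw i)
  have hval : ((x i).val : ℝ) + 1 ≤ N := by exact_mod_cast ZMod.val_lt (x i)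
  rw [Int.cast_natCast] at hlower hupper
  refine ⟨nonneg_of_mul_nonneg_right ((Nat.cast_nonneg _).trans hlower) hN, ?_⟩
  refine lt_of_mul_lt_mul_left ?_ hN.le
  linarith

lemma prod_cell_subset_fundamentalCube (x ξ : Fin n → ZMod N) :
    cell x ×ˢ cell ξ ⊆ fundamentalCube n :=
  fun _ hw i => ⟨mem_Ico_of_mem_cell hw.1 i, mem_Ico_of_mem_cell hw.2 i⟩

lemma residuePt_mem_cell (x : Fin n → ZMod N) : residuePt x ∈ cell x := fun i => by
  have hN : (N : ℝ) ≠ 0 := NeZero.ne _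
  simp only [residuePt, gridPt, mul_div_cancel₀ _ hN, Int.floor_intCast]

lemma dist_le_of_mem_cell {x : Fin n → ZMod N} {w w' : EuclideanSpace ℝ (Fin n)}
    (hw : w ∈ cell x) (hw' : w' ∈ cell x) : dist w w' ≤ n / N := by
  have hN : (0 : ℝ) < N := Nat.cast_pos.2 (NeZero.pos N)
  have hcoord : ∀ i, ‖(w - w') i‖ ≤ (N : ℝ)⁻¹ := fun i => by
    have hfloor := Int.abs_sub_lt_one_of_floor_eq_floor ((hw i).trans (hw' i).symm)
    rw [← mul_sub, abs_mul, Nat.abs_cast] at hfloor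
    rw [PiLp.sub_apply, Real.norm_eq_abs, ← one_div, le_div_iff₀' hN]
    exact hfloor.le
  rw [dist_eq_norm, div_eq_mul_inv]
  simpa only [Fintype.card_fin] using norm_le_card_mul_of_forall_norm_le hcoord

lemma volume_biUnion_prod_cell (s : Finset ((Fin n → ZMod N) × (Fin n → ZMod N))) :
    volume (⋃ p ∈ s, cell p.1 ×ˢ cell p.2) = ENNReal.ofReal (s.card / (N : ℝ) ^ (2 * n)) := by
  have hvolume : ∀ p ∈ s, volume (cell p.1 ×ˢ cell p.2) = ENNReal.ofReal ((N : ℝ) ^ (2 * n))⁻¹ :=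
    fun p _ => by
      rw [Measure.volume_eq_prod, Measure.prod_prod, volume_cell, volume_cell,
        ← ENNReal.ofReal_mul (by positivity), ← mul_inv, ← pow_add, two_mul]
  rw [measure_biUnion_finset (fun p _ q _ hpq => Set.disjoint_left.2 fun w hp hq =>
      hpq (Prod.ext (eq_of_mem_cell hp.1 hq.1) (eq_of_mem_cell hp.2 hq.2)))
    fun p _ => (measurableSet_cell _).prod (measurableSet_cell _), Finset.sum_congr rfl hvolume,
    Finset.sum_const, nsmul_eq_mul, div_eq_mul_inv, ENNReal.ofReal_mul (Nat.cast_nonneg _),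
    ENNReal.ofReal_natCast]

end Cell

variable {f : EuclideanSpace ℝ (Fin n) × EuclideanSpace ℝ (Fin n) → ℂ} {z : ℂ}

lemma IsSmoothOnTorus.exists_lipschitzOnWith (hf : IsSmoothOnTorus f) :
    ∃ L : NNReal, LipschitzOnWith L f (fundamentalCube n) := by
  obtain ⟨L, hL⟩ := LocallyLipschitzOn.exists_lipschitzOnWith_of_compact
    (isBounded_fundamentalCube n).isCompact_closure
    (hf.contDiff.of_le (by simp)).locallyLipschitz.locallyLipschitzOn
  exact ⟨L, hL.mono subset_closure⟩

lemma card_div_pow_le_volume_sublevel {L : NNReal} (hf : LipschitzOnWith L f (fundamentalCube n))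
    {N : ℕ} [NeZero N] (t : ℝ) :
    ENNReal.ofReal (Nat.card {p : (Fin n → ZMod N) × (Fin n → ZMod N) //
        ‖f (residuePt p.1, residuePt p.2) - z‖ ≤ t} / (N : ℝ) ^ (2 * n)) ≤
      volume {w | w ∈ fundamentalCube n ∧ ‖f w - z‖ ≤ t + L * (n / N)} := by
  classical
  rw [Nat.card_eq_fintype_card, Fintype.card_subtype, ← volume_biUnion_prod_cell]
  refine measure_mono fun w hw => ?_
  obtain ⟨p, hp, hwp⟩ := Set.mem_iUnion₂.1 hw
  have hgrid : (residuePt p.1, residuePt p.2) ∈ cell p.1 ×ˢ cell p.2 :=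
    ⟨residuePt_mem_cell _, residuePt_mem_cell _⟩
  have hcube := prod_cell_subset_fundamentalCube p.1 p.2
  have hclose : dist w (residuePt p.1, residuePt p.2) ≤ n / N :=
    max_le (dist_le_of_mem_cell hwp.1 hgrid.1) (dist_le_of_mem_cell hwp.2 hgrid.2)
  refine ⟨hcube hwp, ?_⟩
  rw [← dist_eq_norm]
  calc dist (f w) z
      ≤ dist (f w) (f (residuePt p.1, residuePt p.2)) + dist (f (residuePt p.1, residuePt p.2)) z :=
        dist_triangle _ _ _
    _ ≤ L * (n / N) + t := add_le_add
        ((hf.dist_le_mul _ (hcube hwp) _ (hcube hgrid)).trans (by gcongr))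
        ((dist_eq_norm _ _).trans_le (Finset.mem_filter.1 hp).2)
    _ = t + L * (n / N) := add_comm _ _

lemma SublevelVolumeBound.exists_card_le {κ : ℝ} (hvol : SublevelVolumeBound f z κ)
    {L : NNReal} (hf : LipschitzOnWith L f (fundamentalCube n)) :
    ∃ C t₀ : ℝ, 0 < C ∧ 0 < t₀ ∧ ∀ (N : ℕ) [NeZero N] (t : ℝ), 1 / (N : ℝ) ≤ t → t ≤ t₀ →
      (Nat.card {p : (Fin n → ZMod N) × (Fin n → ZMod N) //
        ‖f (residuePt p.1, residuePt p.2) - z‖ ≤ t} : ℝ) ≤ C * (N : ℝ) ^ (2 * n) * t ^ κ := by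
  obtain ⟨C, t₀, ht₀, hC⟩ := hvol
  set B : ℝ := 1 + L * n
  have hB : 0 < B := by positivity
  refine ⟨max C 1 * B ^ κ, t₀ / B, by positivity, by positivity, fun N _ t hNt ht => ?_⟩
  have hN : (0 : ℝ) < N := Nat.cast_pos.2 (NeZero.pos N)
  have ht_pos : 0 < t := (one_div_pos.2 hN).trans_le hNt
  have henlarge : t + L * (n / N) ≤ B * t := calc
    t + L * (n / N) = t + L * n * (1 / N) := by ring
    _ ≤ t + L * n * t := by gcongr
    _ = B * t := by ring
  have hvolume := calc
    ENNReal.ofReal (Nat.card {p : (Fin n → ZMod N) × (Fin n → ZMod N) //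
        ‖f (residuePt p.1, residuePt p.2) - z‖ ≤ t} / (N : ℝ) ^ (2 * n))
      ≤ volume {w | w ∈ fundamentalCube n ∧ ‖f w - z‖ ≤ t + L * (n / N)} :=
        card_div_pow_le_volume_sublevel hf t
    _ ≤ volume {w | w ∈ fundamentalCube n ∧ ‖f w - z‖ ≤ B * t} :=
        measure_mono fun w hw => ⟨hw.1, hw.2.trans henlarge⟩
    _ ≤ ENNReal.ofReal (C * (B * t) ^ κ) := hC _ (by positivity) ((le_div_iff₀' hB).1 ht)
    _ ≤ ENNReal.ofReal (max C 1 * (B * t) ^ κ) := by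
        gcongr
        exact le_max_left C 1
  rw [ENNReal.ofReal_le_ofReal_iff (by positivity), div_le_iff₀ (by positivity),
    Real.mul_rpow hB.le ht_pos.le] at hvolume
  exact hvolume.trans_eq (by ring)

end Volume

section RankBound

open scoped Matrix

lemma one_div_le_sq_of_rpow_neg_le {N : ℕ} [NeZero N] {ρ α : ℝ} (hρ : ρ ≤ 1 / 2)
    (hα : (N : ℝ) ^ (-ρ) ≤ α) : 1 / (N : ℝ) ≤ α ^ 2 := by
  have hN : (1 : ℝ) ≤ N := Nat.one_le_cast.2 (NeZero.pos N)
  calc 1 / (N : ℝ) = (N : ℝ) ^ (-1 : ℝ) := by rw [Real.rpow_neg_one, one_div]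
    _ ≤ (N : ℝ) ^ (-ρ * 2) := Real.rpow_le_rpow_of_exponent_le hN (by linarith)
    _ = ((N : ℝ) ^ (-ρ)) ^ 2 := by rw [Real.rpow_mul (by positivity), Real.rpow_two]
    _ ≤ α ^ 2 := by gcongr

lemma IsSmoothOnTorus.exists_pow_mul_rank_matrixFun_le_card_norm_le {n : ℕ}
    {f : EuclideanSpace ℝ (Fin n) × EuclideanSpace ℝ (Fin n) → ℂ} (hf : IsSmoothOnTorus f)
    {K : Set ℝ} (hK : BddAbove K) :
    ∃ B : ℝ, 1 ≤ B ∧ ∀ ψ : ℝ → ℂ, Function.support ψ ⊆ K → ∀ (N : ℕ) [NeZero N] (α : ℝ),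
      0 < α → 1 / (N : ℝ) ≤ α ^ 2 →
        (N : ℝ) ^ n * (matrixFun ψ ((α ^ 2)⁻¹ • (quantize f N * (quantize f N)ᴴ))).rank ≤
          2 * Nat.card {p : (Fin n → ZMod N) × (Fin n → ZMod N) //
            ‖f (residuePt p.1, residuePt p.2)‖ ≤ B * α} := by
  obtain ⟨R, hR⟩ := hK
  obtain ⟨D, hD, hrank⟩ := hf.exists_pow_mul_rank_matrixFun_le
  refine ⟨√(2 * (max R 1 + D)), Real.one_le_sqrt.2 (by linarith [le_max_right R 1]),
    fun ψ hψ N _ α hα hN => (hrank N (α ^ 2) (max R 1) ψ (by positivity) (by positivity)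
      fun t ht => (hR (hψ ht)).trans (le_max_left R 1)).trans ?_⟩
  gcongr
  refine Nat.card_le_card_of_injective _ (Subtype.map_injective (fun p hp => ?_)
    Function.injective_id)
  rw [← Real.sqrt_sq hα.le, ← Real.sqrt_mul (by positivity)]
  refine Real.le_sqrt_of_sq_le (hp.trans ?_)
  calc 2 * (max R 1 * α ^ 2 + D / N) = 2 * (max R 1 * α ^ 2 + D * (1 / N)) := by ring
    _ ≤ 2 * (max R 1 * α ^ 2 + D * α ^ 2) := by gcongr
    _ = 2 * (max R 1 + D) * α ^ 2 := by ring

end RankBound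

end TorusQuantization

end

open TorusQuantization in
theorem proposition2p9_general (n : ℕ)
    (f : EuclideanSpace ℝ (Fin n) × EuclideanSpace ℝ (Fin n) → ℂ) (hf : IsSmoothOnTorus f)
    (κ : ℝ) (hvol : SublevelVolumeBound f 0 κ)
    (ρ : ℝ) (hρ : ρ ≤ 1 / 2) (K : Set ℝ) (hK : BddAbove K) :
    ∃ C α₀ : ℝ, 0 < C ∧ 0 < α₀ ∧
      ∀ ψ : ℝ → ℂ, Function.support ψ ⊆ K →
        ∀ (N : ℕ) [NeZero N] (α : ℝ), (N : ℝ) ^ (-ρ) ≤ α → α ≤ α₀ →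
          ((matrixFun ψ (((α ^ 2)⁻¹ : ℝ) • (quantize f N * (quantize f N).conjTranspose))).rank : ℝ)
            ≤ C * (N : ℝ) ^ n * α ^ κ := by
  obtain ⟨B, hB, hrank⟩ := hf.exists_pow_mul_rank_matrixFun_le_card_norm_le hK
  obtain ⟨L, hL⟩ := hf.exists_lipschitzOnWith
  obtain ⟨C, t₀, hC, ht₀, hcard⟩ := hvol.exists_card_le hL
  have hB_pos : 0 < B := one_pos.trans_le hB
  refine ⟨2 * C * B ^ κ, min 1 (t₀ / B), by positivity, by positivity,
    fun ψ hψ N _ α hNα hα => ?_⟩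
  have hN : (0 : ℝ) < N := Nat.cast_pos.2 (NeZero.pos N)
  have hα_pos : 0 < α := (Real.rpow_pos_of_pos hN _).trans_le hNα
  have hα_sq : 1 / (N : ℝ) ≤ α ^ 2 := one_div_le_sq_of_rpow_neg_le hρ hNα
  have hscale : 1 / (N : ℝ) ≤ B * α := calc
    1 / (N : ℝ) ≤ α ^ 2 := hα_sq
    _ ≤ α := pow_le_of_le_one hα_pos.le (hα.trans (min_le_left _ _)) two_ne_zero
    _ ≤ B * α := le_mul_of_one_le_left hα_pos.le hB
  have hcount := hcard N (B * α) hscale ((le_div_iff₀' hB_pos).1 (hα.trans (min_le_right _ _)))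
  simp only [sub_zero] at hcount
  refine le_of_mul_le_mul_left ((hrank ψ hψ N α hα_pos hα_sq).trans ?_) (pow_pos hN n)
  calc 2 * (Nat.card {p : (Fin n → ZMod N) × (Fin n → ZMod N) //
        ‖f (residuePt p.1, residuePt p.2)‖ ≤ B * α} : ℝ)
      ≤ 2 * (C * (N : ℝ) ^ (2 * n) * (B * α) ^ κ) := by gcongr
    _ = (N : ℝ) ^ n * (2 * C * B ^ κ * (N : ℝ) ^ n * α ^ κ) := by
      rw [Real.mul_rpow hB_pos.le hα_pos.le, two_mul n, pow_add]
      ring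

open TorusQuantization in
theorem proposition2p9 (n : ℕ)
    (f : EuclideanSpace ℝ (Fin n) × EuclideanSpace ℝ (Fin n) → ℂ) (hf : IsSmoothOnTorus f)
    (κ : ℝ) (hκ : 0 < κ) (hvol : SublevelVolumeBound f 0 κ)
    (ρ : ℝ) (hρ : ρ < 1 / 2) (K : Set ℝ) (hK : IsCompact K) :
    ∃ C α₀ : ℝ, 0 < C ∧ 0 < α₀ ∧
      ∀ ψ : ℝ → ℂ, ContDiff ℝ ∞ ψ → tsupport ψ ⊆ K →
        ∀ (N : ℕ) [NeZero N] (α : ℝ), (N : ℝ) ^ (-ρ) ≤ α → α ≤ α₀ →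
          ((matrixFun ψ (((α ^ 2)⁻¹ : ℝ) • (quantize f N * (quantize f N).conjTranspose))).rank : ℝ)
            ≤ C * (N : ℝ) ^ n * α ^ κ := by
  obtain ⟨C, α₀, hC, hα₀, h⟩ := proposition2p9_general n f hf κ hvol ρ hρ.le K hK.bddAbove
  exact ⟨C, α₀, hC, hα₀, fun ψ _ hψ => h ψ ((subset_tsupport ψ).trans hψ)⟩
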